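/- Let $p$ be a prime, $q=p^l$ with $l\ge 1$, and $m\ge 2$. Write $\mathrm{Tr}$ for the trace from $\mathbb{F}_{q^m}$ to $\mathbb{F}_q$, and let $f_2(x)=\mathrm{Tr}(x)$, $g_2(y)=\mathrm{Tr}(y^2)$ and $\mathcal{D}=\{(x,y)\in\mathbb{F}_{q^m}^2 : f_2(x)+g_2(y)=0\}$. Let $\mathcal{C}_{f_2,g_2}$ be the linear code over $\mathbb{F}_{q^m}$ of length $1+\#\mathcal{D}$ generated by the $3\times(1+\#\mathcal{D})$ matrix whose first column is $(0,1,0)^T$ and whose other columns are $(1,x,y)^T$, $(x,y)\in\mathcal{D}$. Its subfield code $\mathcal{C}_{f_2,g_2}^{(q)}$ is the code over $\mathbb{F}_q$ generated by the matrix obtained from a generator matrix of $\mathcal{C}_{f_2,g_2}$ by replacing every entry with the column of its coordinates in a basis of $\mathbb{F}_{q^m}$ over $\mathbb{F}_q$ (for any choice of the generator matrix and of the basis), and $\bar{\mathcal{C}}_{f_2,g_2}^{(q)}$ is the code obtained from it by deleting the first coordinate. An $[n,k,d]$ code is a linear code of length $n$, dimension $k$ and minimum Hamming distance $d$; it is optimal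 if no $[n,k,d']$ code over the same field with $d'>d$ exists. A code is a $t$-weight code if its nonzero codewords have exactly $t$ distinct Hamming weights. The following hold. (1) If $q=2$, then $\bar{\mathcal{C}}_{f_2,g_2}^{(2)}$ is an optimal $[2^{2m-1},2m,2^{2m-2}]$ binary code which meets the Griesmer bound $n\ge\sum_{i=0}^{k-1}\lceil d/2^i\rceil$ with equality, its weight enumerator is $1+(2^{2m}-2)z^{2^{2m-2}}+z^{2^{2m-1}}$, and up to the order of the coordinates it is the first order Reed-Muller code $\mathcal{RM}(1,2m-1)$. Its dual is an optimal $[2^{2m-1},2^{2m-1}-2m,4]$ binary code with respect to the sphere-packing bound $2^n\ge 2^k\sum_{i=0}^{\lfloor (d-1)/2\rfloor}\binom{n}{i}$; that is, this bound excludes all $[2^{2m-1},2^{2m-1}-2m,d']$ binary codes with $d'>4$. (2) If $q=2^l$ with $l\ge2$, then $\bar{\mathcal{C}}_{f_2,g_2}^{(q)}$ is a three-weight $[q^{2m-1},2m+1,(q-2)q^{2m-2}]$ code over $\mathbb{F}_q$. Apart from the zero word, it has $\frac{q(q-1)^2}{2}$ codewords of weight $(q-2)q^{2m-2}$, $q^{2m+1}-q^3+2q^2-2q$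 codewords of weight $(q-1)q^{2m-2}$, $\frac{(q-1)(q^2-q+2)}{2}$ codewords of weight $q^{2m-1}$, and no others. (3) If $q$ and $m$ are odd, then $\bar{\mathcal{C}}_{f_2,g_2}^{(q)}$ is a four-weight $[q^{2m-1},2m+1,(q-1)q^{2m-2}-q^{\frac{3m-3}{2}}]$ code over $\mathbb{F}_q$. Apart from the zero word, it has $\frac{q^m(q-1)^2}{2}$ codewords of weight $(q-1)q^{2m-2}-q^{\frac{3m-3}{2}}$, $q^{2m+1}-q^{m+2}+2q^{m+1}-q^m-q$ codewords of weight $(q-1)q^{2m-2}$, $\frac{q^m(q-1)^2}{2}$ codewords of weight $(q-1)q^{2m-2}+q^{\frac{3m-3}{2}}$, $q-1$ codewords of weight $q^{2m-1}$, and no others. (4) If $q$ is odd and $m$ is even, then $\bar{\mathcal{C}}_{f_2,g_2}^{(q)}$ is a four-weight code over $\mathbb{F}_q$ of length $q^{2m-1}$ and dimension $2m+1$. Apart from the zero word, it has $q^{m+2}-2q^{m+1}+q^m$ codewords of weight $(q-1)q^{2m-2}+q^{\frac{3m-4}{2}}(-1)^{\frac{lm(p-1)+4}{4}}$, $q^{m+1}-q^m$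 codewords of weight $(q-1)q^{2m-2}+(q-1)q^{\frac{3m-4}{2}}(-1)^{\frac{lm(p-1)}{4}}$, $q^{2m+1}-q^{m+2}+q^{m+1}-q$ codewords of weight $(q-1)q^{2m-2}$, $q-1$ codewords of weight $q^{2m-1}$, and no others. In the cases (2), (3) and (4), the dual of $\bar{\mathcal{C}}_{f_2,g_2}^{(q)}$ is a $[q^{2m-1},q^{2m-1}-2m-1,3]$ code over $\mathbb{F}_q$. -/

import Mathlib

open Polynomial

/-! ### Linear codes

A linear code of length `Fintype.card ι` over a finite field `F` is a subspace of `ι → F`;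
the coordinates are indexed by the finite type `ι`. -/

section LinearCodes

variable {F : Type*} [Field F] [DecidableEq F] {ι : Type*} [Fintype ι]

/-- `C` is an `[n, k]` linear code: it has length `n` and dimension `k`. -/
def IsLinearCode (C : Submodule F (ι → F)) (n k : ℕ) : Prop :=
  Fintype.card ι = n ∧ Module.finrank F C = k

/-- `d` is the minimum Hamming distance between distinct codewords of `C`. -/
def HasMinDist (C : Submodule F (ι → F)) (d : ℕ) : Prop :=
  IsLeast {e : ℕ | ∃ u ∈ C, ∃ v ∈ C, u ≠ v ∧ hammingDist u v = e} d

/-- `C` is an `[n, k, d]` linear code. -/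
def IsLinearCodeWithDist (C : Submodule F (ι → F)) (n k d : ℕ) : Prop :=
  IsLinearCode C n k ∧ HasMinDist C d

/-- `C` is an optimal `[n, k, d]` linear code: an `[n, k, d]` linear code such that no
`[n, k, d']` linear code over `F` with `d' > d` exists. -/
def IsOptimalCode (C : Submodule F (ι → F)) (n k d : ℕ) : Prop :=
  IsLinearCodeWithDist C n k d ∧
    ∀ d' : ℕ, d < d' → ¬ ∃ C' : Submodule F (Fin n → F), IsLinearCodeWithDist C' n k d'

/-- The dual code, with respect to the standard inner product. -/
def dualCode (C : Submodule F (ι → F)) : Submodule F (ι → F) where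
  carrier := {x | ∀ c ∈ C, x ⬝ᵥ c = 0}
  add_mem' := by
    intro x y hx hy c hc
    rw [add_dotProduct, hx c hc, hy c hc, add_zero]
  zero_mem' := by
    intro c _
    exact zero_dotProduct c
  smul_mem' := by
    intro a x hx c hc
    rw [smul_dotProduct, hx c hc, smul_zero]

/-- The number `A_w` of codewords of Hamming weight `w`. -/
noncomputable def weightCount (C : Submodule F (ι → F)) (w : ℕ) : ℕ :=
  Set.ncard {c : ι → F | c ∈ C ∧ hammingNorm c = w}

/-- The weight enumerator `A_0 + A_1 z + ⋯ + A_n z ^ n`, where `n` is the length. -/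
noncomputable def weightEnumerator (C : Submodule F (ι → F)) : ℤ[X] :=
  ∑ w ∈ Finset.range (Fintype.card ι + 1), Polynomial.C (weightCount C w : ℤ) * X ^ w

/-- `C` is a `t`-weight code: exactly `t` of the numbers `A_1, …, A_n` are nonzero. -/
def IsWeightCode (C : Submodule F (ι → F)) (t : ℕ) : Prop :=
  Set.ncard {w : ℕ | 1 ≤ w ∧ w ≤ Fintype.card ι ∧ weightCount C w ≠ 0} = t

/-- `C` has the weight distribution given by a table with rows `(weight, multiplicity)`: for every
`w`, the number `A_w` is the (total) multiplicity of the weight `w` in the table; in particular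
`A_w = 0` if `w` is not in the table. -/
def HasWeightDistribution (C : Submodule F (ι → F)) (table : List (ℤ × ℚ)) : Prop :=
  ∀ w : ℕ, (weightCount C w : ℚ) =
    (table.map fun r => if r.1 = (w : ℤ) then r.2 else 0).sum

end LinearCodes

/-! ### Bounds -/

/-- The parameters `[n, k, d]` meet the Griesmer bound over a field with `q` elements:
`n = ∑_{i < k} ⌈d / q ^ i⌉`. -/
def MeetsGriesmerBound (q n k d : ℕ) : Prop :=
  (n : ℤ) = ∑ i ∈ Finset.range k, ⌈(d : ℚ) / (q : ℚ) ^ i⌉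

/-- The sphere packing inequality for an `[n, k, d]` code over a field with `q` elements:
`q ^ k * ∑_{i ≤ t} (n choose i) (q - 1) ^ i ≤ q ^ n` with `t = ⌊(d - 1) / 2⌋`. -/
def SatisfiesSpherePackingBound (q n k d : ℕ) : Prop :=
  q ^ k * ∑ i ∈ Finset.range ((d - 1) / 2 + 1), n.choose i * (q - 1) ^ i ≤ q ^ n

/-- Parameters `[n, k, d]` are optimal with respect to the sphere packing bound: this bound is
violated by `[n, k, d']` for all `d' > d`. -/
def OptimalForSpherePacking (q n k d : ℕ) : Prop :=
  ∀ d' : ℕ, d < d' → ¬ SatisfiesSpherePackingBound q n k d'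

/-! ### Reed-Muller codes -/

/-- The Reed-Muller code `RM(r, n)` (for a field `F` with two elements): the vectors of values at
the points of `F ^ n` of the polynomials in `n` variables of degree at most `r`. -/
noncomputable def reedMuller (F : Type*) [Field F] (r n : ℕ) : Submodule F ((Fin n → F) → F) :=
  (MvPolynomial.restrictTotalDegree (Fin n) F r).map (MvPolynomial.evalₗ F (Fin n))

/-- Two codes are equal up to a relabelling of the coordinates. -/
def PermEquivalent {F : Type*} [Field F] {ι κ : Type*} (C : Submodule F (ι → F))
    (C' : Submodule F (κ → F)) : Prop :=
  ∃ e : ι ≃ κ, C = C'.map (LinearMap.funLeft F F e)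

/-! ### Subfield codes and the codes `C_{f,g}` -/

/-- The code generated by the rows of a matrix. -/
def rowCode {F : Type*} [Field F] {r ι : Type*} (G : Matrix r ι F) : Submodule F (ι → F) :=
  Submodule.span F (Set.range G.row)

/-- The matrix over `K` obtained from a matrix `G` over `L` by replacing every entry with the column
vector of its coordinates in the `K`-basis `B` of `L`. -/
noncomputable def expandMatrix {K L : Type*} [Field K] [Field L] [Algebra K L] {κ r ι : Type*}
    (B : Module.Basis κ K L) (G : Matrix r ι L) : Matrix (r × κ) ι K :=
  Matrix.of fun ij n => B.repr (G ij.1 n) ij.2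

/-- The subfield code over `K` of the code over `L` generated by `G`, computed with the `K`-basis
`B` of `L`. -/
noncomputable def subfieldCode {K L : Type*} [Field K] [Field L] [Algebra K L] {κ r ι : Type*}
    (B : Module.Basis κ K L) (G : Matrix r ι L) : Submodule K (ι → K) :=
  rowCode (expandMatrix B G)

/-- Puncturing at the coordinate `none`: this coordinate is deleted from every codeword. -/
def punctureFirst {F : Type*} [Field F] {α : Type*} (C : Submodule F (Option α → F)) :
    Submodule F (α → F) :=
  C.map (LinearMap.funLeft F F (some : α → Option α))

section CodesFG

variable {K L : Type*} [Field K] [DecidableEq K] [Field L] [Fintype L]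

/-- The set `D` of all `(x, y)` with `f x + g y = 0`. -/
def solutionSet (f g : L → K) : Finset (L × L) :=
  Finset.univ.filter fun p => f p.1 + g p.2 = 0

/-- The `3 × (1 + #D)` matrix over `L` whose first column (with index `none`) is `(0, 1, 0)` and
whose other columns are `(1, x, y)` for `(x, y)` in `D`. -/
def genMatrix (f g : L → K) : Matrix (Fin 3) (Option (solutionSet f g)) L :=
  Matrix.of fun i j =>
    match j with
    | none => ![0, 1, 0] i
    | some p => ![1, p.1.1, p.1.2] i

/-- The code `C_{f,g}` over `L`. -/
def codeFG (f g : L → K) : Submodule L (Option (solutionSet f g) → L) :=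
  rowCode (genMatrix f g)

end CodesFG

set_option linter.unusedSectionVars false

/-! Write `q = #K`. Nondegeneracy of the trace form makes the punctured subfield code the image of
the linear map `traceEval`, which sends `(t, b, c)` to the values `t + Tr (b x) + Tr (c y)` on `D`
(`punctureFirst_subfieldCode_eq_range`). So everything reduces to counting the zeros of such a
function on `D`, triple by triple.

If `b ∉ K`, then `Tr x` and `Tr (b x)` are independent, every `y` admits `q ^ (m - 2)` values of
`x`, and the weight is `(q - 1) q ^ (2m - 2)` (`zeroCount_of_notMem`). If `b = β ∈ K`, the equation
of `D` eliminates `x`, and there remain `q ^ (m - 1)` times the solutions `y` of `t + Tr (c y) = β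
Tr (y ^ 2)` (`zeroCount_algebraMap`). For `β = 0` this is a linear equation. For `β ≠ 0` the
characteristic matters.

Odd `q`: completing the square turns the count into `Z(s) = #{y | Tr (y ^ 2) = s}`, where `s` runs
once over `K` as `t` does. No Gauss sums are needed: the substitution `(u, v) = (y - y', y + y')`
gives the second moment of `Z` (`sum_traceSqCount_sq`), and symmetry leaves few unknowns. For odd
`m`, nonsquares of `K` stay nonsquares in `L`, so `Z(s) = q ^ (m - 1) + χ(s) δ` with `δ ^ 2 = q ^ (m
- 1)`; the sign of `δ` does not affect the weight distribution. For even `m`, take the intermediate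
field `E` with `[L : E] = 2`: all of `E` is square in `L`, so the count over `E` is constant off `0`
and known up to a sign, which `#E mod 4` decides; transitivity of the trace brings it down to `K`
(`traceSqCount_of_even`).

Even `q`: `Tr (y ^ 2) = (Tr y) ^ 2`. For `c ∉ K` independence gives the middle weight again; for `c
= γ ∈ K` the count is governed by the roots in `K` of `β u ^ 2 - γ u = t` (`weight_of_charTwo`).

Counts of triples become counts of codewords on division by the size of the kernel
(`card_hammingNorm_eq_mul`), which is `1` for `q > 2` and `2` for `q = 2`. The dual has distance at
least `3` because affine functions separate points, and three points of `D` on a line attain it. For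
`q = 2`, `D` is a hyperplane of `L × L` and the code consists of all affine functions on it, hence
is Reed-Muller; the all-one word raises the dual distance to `4`. Optimality follows from the
average weight bound for the code (`plotkin_bound`) and from sphere packing for its dual
(`card_mul_choose_two_le`). -/

open Finset in
theorem card_fiber_mul_card {V W : Type*} [AddCommGroup V] [AddCommGroup W] [Fintype V] [Fintype W]
    [DecidableEq W] (f : V →+ W) (hf : Function.Surjective f) (w : W) :
    #{v | f v = w} * Fintype.card W = Fintype.card V := by
  have h : ∀ u : W, #{v | f v = u} = #{v | f v = w} := fun u =>
    AddMonoidHom.card_fiber_eq_of_mem_range f (hf u) (hf w)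
  have h2 := Finset.card_eq_sum_card_fiberwise (f := f) (s := univ) (t := univ) (by simp)
  simp only [h, sum_const, card_univ, smul_eq_mul] at h2
  rw [h2, mul_comm]


/-! ### Level sets of trace functionals and the second moment of `Tr (y ^ 2)` -/

section FiniteFields

variable {K L : Type*} [Field K] [Fintype K] [DecidableEq K] [Field L] [Fintype L] [Algebra K L]

open Finset in
theorem card_trace_eq_mul (s : K) :
    #{x : L | Algebra.trace K L x = s} * Fintype.card K = Fintype.card L :=
  card_fiber_mul_card (Algebra.trace K L).toAddMonoidHom (Algebra.trace_surjective K L) s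

theorem eq_zero_of_trace_mul_eq_zero {a : L} (h : ∀ x, Algebra.trace K L (a * x) = 0) : a = 0 :=
  (traceForm_nondegenerate K L).1 a h

theorem exists_trace_mul_eq (φ : L →ₗ[K] K) : ∃ b : L, ∀ x, φ x = Algebra.trace K L (b * x) := by
  have h := ((Algebra.traceForm K L).toDual (traceForm_nondegenerate K L)).surjective φ
  obtain ⟨b, hb⟩ := h
  refine ⟨b, fun x => ?_⟩
  rw [← hb]
  rfl

open Finset in
theorem card_trace_mul_eq_mul {a : L} (ha : a ≠ 0) (s : K) :
    #{x : L | Algebra.trace K L (a * x) = s} * Fintype.card K = Fintype.card L := by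
  refine card_fiber_mul_card ((Algebra.trace K L).comp (LinearMap.mulLeft K a)).toAddMonoidHom
    (fun u => ?_) s
  obtain ⟨x, hx⟩ := Algebra.trace_surjective K L u
  exact ⟨a⁻¹ * x, by simp [mul_inv_cancel_left₀ ha, hx]⟩

/-- A proper image would be killed by a nonzero functional `φ` on `K × K`. Then `φ (1, 0) + φ (0, 1)
b` is trace-orthogonal to all of `L`, hence zero, which forces `b ∈ K`. -/
theorem surjective_trace_prod {b : L} (hb : b ∉ Set.range (algebraMap K L)) :
    Function.Surjective fun x : L => (Algebra.trace K L x, Algebra.trace K L (b * x)) := by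
  let T : L →ₗ[K] K × K :=
    (Algebra.trace K L).prod ((Algebra.trace K L).comp (LinearMap.mulLeft K b))
  change Function.Surjective T
  rw [← LinearMap.range_eq_top]
  by_contra hne
  obtain ⟨φ, hφ, hle⟩ := Submodule.exists_le_ker_of_lt_top _ (lt_top_iff_ne_top.2 hne)
  have h1 : ∀ u v : K, φ (u, v) = φ (1, 0) * u + φ (0, 1) * v := by
    intro u v
    have : ((u, v) : K × K) = u • (1, 0) + v • (0, 1) := by simp
    rw [this, map_add, map_smul, map_smul, smul_eq_mul, smul_eq_mul, mul_comm, mul_comm v]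
  have h2 : algebraMap K L (φ (1, 0)) + algebraMap K L (φ (0, 1)) * b = 0 := by
    refine eq_zero_of_trace_mul_eq_zero (K := K) fun x => ?_
    have h3 : φ (T x) = 0 := hle ⟨x, rfl⟩
    rw [show T x = (Algebra.trace K L x, Algebra.trace K L (b * x)) from rfl, h1] at h3
    rw [add_mul, map_add, mul_assoc, ← Algebra.smul_def, ← Algebra.smul_def, map_smul, map_smul]
    exact h3
  by_cases h0 : φ (0, 1) = 0
  · rw [h0, map_zero, zero_mul, add_zero, map_eq_zero] at h2
    apply hφ
    ext <;> simp [h0, h2]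
  · apply hb
    refine ⟨-φ (1, 0) / φ (0, 1), ?_⟩
    have : algebraMap K L (φ (0, 1)) ≠ 0 := by simpa using h0
    rw [map_div₀, map_neg, div_eq_iff this]
    linear_combination -h2

open Finset in
theorem card_trace_prod_eq_mul {b : L} (hb : b ∉ Set.range (algebraMap K L)) (u v : K) :
    #{x : L | Algebra.trace K L x = u ∧ Algebra.trace K L (b * x) = v} * Fintype.card K ^ 2
      = Fintype.card L := by
  have := card_fiber_mul_card ((Algebra.trace K L).prod
    ((Algebra.trace K L).comp (LinearMap.mulLeft K b))).toAddMonoidHom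
    (surjective_trace_prod hb) (u, v)
  rw [Fintype.card_prod, ← sq] at this
  rw [← this]
  congr 2
  ext x
  simp

/-! ### The number of solutions of `Tr (y ^ 2) = s` in odd characteristic -/

variable (K L) in
open Finset in
/-- The number of `y` in `L` with `Tr (y ^ 2) = s`. -/
noncomputable def traceSqCount (s : K) : ℕ := #{y : L | Algebra.trace K L (y ^ 2) = s}

theorem sum_traceSqCount : ∑ s : K, traceSqCount K L s = Fintype.card L := by
  have h := Finset.card_eq_sum_card_fiberwise (f := fun y : L => Algebra.trace K L (y ^ 2))
    (s := Finset.univ) (t := Finset.univ) (by simp)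
  exact h.symm

open Finset in
-- The sum of squares counts pairs with `Tr (y ^ 2) = Tr (y' ^ 2)`. Since `2` is invertible, `(u, v)
-- = (y - y', y + y')` is a bijective change of variables and the condition becomes `Tr (u v) = 0`:
-- all `v` when `u = 0`, and a fraction `1 / #K` of them otherwise.
theorem sum_traceSqCount_sq (h2 : (2 : L) ≠ 0) :
    (∑ s : K, traceSqCount K L s ^ 2) * Fintype.card K
      = Fintype.card L * Fintype.card K + (Fintype.card L - 1) * Fintype.card L := by
  classical
  have e1 : ∑ s : K, traceSqCount K L s ^ 2 =
      #{p : L × L | Algebra.trace K L (p.1 ^ 2) = Algebra.trace K L (p.2 ^ 2)} := by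
    rw [Finset.card_eq_sum_card_fiberwise (f := fun p : L × L => Algebra.trace K L (p.1 ^ 2))
      (t := univ) (by simp)]
    refine Finset.sum_congr rfl fun s _ => ?_
    rw [sq, traceSqCount, ← Finset.card_product]
    congr 1
    ext p
    simp only [mem_product, mem_filter, mem_univ, true_and]
    constructor
    · rintro ⟨h, h'⟩; exact ⟨h.trans h'.symm, h⟩
    · rintro ⟨h, h'⟩; exact ⟨h', h ▸ h'⟩
  have e2 : #{p : L × L | Algebra.trace K L (p.1 ^ 2) = Algebra.trace K L (p.2 ^ 2)} =
      #{p : L × L | Algebra.trace K L (p.1 * p.2) = 0} := by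
    refine Finset.card_bij' (fun p _ => (p.1 - p.2, p.1 + p.2))
      (fun p _ => ((p.1 + p.2) / 2, (p.2 - p.1) / 2)) ?_ ?_ ?_ ?_
    · rintro ⟨a, b⟩ h
      simp only [mem_filter, mem_univ, true_and] at h ⊢
      rw [show (a - b) * (a + b) = a ^ 2 - b ^ 2 by ring, map_sub, h, sub_self]
    · rintro ⟨a, b⟩ h
      simp only [mem_filter, mem_univ, true_and] at h ⊢
      rw [← sub_eq_zero, ← map_sub, ← h]
      congr 1
      field_simp
      ring
    · rintro ⟨a, b⟩ -
      ext <;> field_simp <;> ring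
    · rintro ⟨a, b⟩ -
      ext <;> field_simp <;> ring
  have e3 : #{p : L × L | Algebra.trace K L (p.1 * p.2) = 0} =
      ∑ u : L, #{v : L | Algebra.trace K L (u * v) = 0} := by
    rw [Finset.card_eq_sum_card_fiberwise (f := Prod.fst) (t := univ) (by simp)]
    refine Finset.sum_congr rfl fun u _ => ?_
    refine Finset.card_bij' (fun p _ => p.2) (fun v _ => (u, v)) ?_ ?_ ?_ ?_
    · rintro ⟨a, b⟩ h
      simp only [mem_filter, mem_univ, true_and] at h ⊢
      rw [← h.2]; exact h.1
    · intro v h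
      simpa using h
    · rintro ⟨a, b⟩ h
      simp only [mem_filter, mem_univ, true_and] at h ⊢
      rw [h.2]
    · intro v _; rfl
  rw [e1, e2, e3, Finset.sum_mul, ← Finset.add_sum_erase _ _ (mem_univ (0 : L))]
  congr 1
  · simp
  · rw [Finset.sum_congr rfl fun u hu => card_trace_mul_eq_mul (Finset.ne_of_mem_erase hu) (0 : K)]
    simp

/-- Substitute `y ↦ w y`. Only `w ^ 2` has to lie in `K`, so elements of `K` that become squares in
`L` are allowed as factors. -/
theorem traceSqCount_mul_sq {w : L} (hw : w ≠ 0) {s u : K} (hu : algebraMap K L u = w ^ 2) :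
    traceSqCount K L (u * s) = traceSqCount K L s := by
  symm
  refine Finset.card_bij' (fun y _ => w * y) (fun y _ => w⁻¹ * y) ?_ ?_ ?_ ?_
  · intro y h
    simp only [Finset.mem_filter, Finset.mem_univ, true_and] at h ⊢
    rw [mul_pow, ← hu, ← Algebra.smul_def, map_smul, h, smul_eq_mul]
  · intro y h
    simp only [Finset.mem_filter, Finset.mem_univ, true_and] at h ⊢
    have hu0 : u ≠ 0 := by
      rintro rfl
      rw [map_zero] at hu
      exact pow_ne_zero 2 hw hu.symm
    apply mul_left_cancel₀ hu0
    rw [← h, ← smul_eq_mul, ← map_smul, Algebra.smul_def, hu, mul_pow, inv_pow,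
      mul_inv_cancel_left₀ (pow_ne_zero 2 hw)]
  · intro y _; simp [hw]
  · intro y _; simp [hw]

end FiniteFields

/-! ### Exact values of `#{y | Tr (y ^ 2) = s}` in odd and in even degree -/

section OddCharacteristic

variable {K L : Type*} [Field K] [Fintype K] [DecidableEq K] [Field L] [Fintype L] [Algebra K L]

open Finset in
-- The maps `y ↦ y ^ 2` and `y ↦ z y ^ 2` together hit every `u` exactly twice: the numbers of
-- preimages are `1 + χ(u)` and `1 - χ(u)`.
theorem card_sq_add_card_mul_sq (hL : ringChar L ≠ 2) {z : L} (hz : ¬ IsSquare z)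
    (P : L → Prop) [DecidablePred P] :
    #{y : L | P (y ^ 2)} + #{y : L | P (z * y ^ 2)} = 2 * #{u : L | P u} := by
  classical
  have hz0 : z ≠ 0 := by rintro rfl; exact hz (IsSquare.zero)
  have key : ∀ u : L, #{y : L | y ^ 2 = u} + #{y : L | z * y ^ 2 = u} = 2 := by
    intro u
    have h1 := quadraticChar_card_sqrts hL u
    have h2 := quadraticChar_card_sqrts hL (z⁻¹ * u)
    have h3 : quadraticChar L z⁻¹ = -1 := by
      rw [quadraticChar_neg_one_iff_not_isSquare]
      rwa [isSquare_inv]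
    rw [map_mul, h3] at h2
    have e1 : #{x : L | x ^ 2 = u} = #({x : L | x ^ 2 = u} : Set L).toFinset := by
      congr 1; ext; simp
    have e2 : #{x : L | z * x ^ 2 = u} = #({x : L | x ^ 2 = z⁻¹ * u} : Set L).toFinset := by
      congr 1; ext x; simp [eq_inv_mul_iff_mul_eq₀ hz0]
    rw [e1, e2]
    have : ((#({x : L | x ^ 2 = u} : Set L).toFinset +
      #({x : L | x ^ 2 = z⁻¹ * u} : Set L).toFinset : ℕ) : ℤ) = 2 := by
      push_cast
      rw [h1, h2]; ring
    exact_mod_cast this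
  have split : ∀ g : L → L, #{y : L | P (g y)} = ∑ u : L with P u, #{y : L | g y = u} := by
    intro g
    rw [Finset.card_eq_sum_card_fiberwise (f := g) (t := univ.filter P)]
    · refine Finset.sum_congr rfl fun u hu => ?_
      congr 1
      ext y
      simp only [mem_filter, mem_univ, true_and] at hu ⊢
      exact ⟨fun h => h.2, fun h => ⟨h ▸ hu, h⟩⟩
    · intro y hy
      simpa using hy
  rw [split, split (fun y => z * y ^ 2), ← Finset.sum_add_distrib,
    Finset.sum_congr rfl fun u _ => key u, Finset.sum_const, smul_eq_mul, mul_comm]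

/-- The norm of `z` is an odd power of `z`, and norms of squares are squares. -/
theorem not_isSquare_algebraMap (hodd : Odd (Module.finrank K L)) {z : K} (hz : ¬ IsSquare z) :
    ¬ IsSquare (algebraMap K L z) := by
  rintro ⟨w, hw⟩
  have h := congrArg (Algebra.norm K) hw
  rw [Algebra.norm_algebraMap, map_mul] at h
  obtain ⟨j, hj⟩ := hodd
  have hz0 : z ≠ 0 := by rintro rfl; exact hz (IsSquare.zero)
  apply hz
  refine ⟨Algebra.norm K w / z ^ j, ?_⟩
  rw [hj, pow_succ, two_mul, pow_add] at h
  have := pow_ne_zero j hz0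
  field_simp
  linear_combination h

theorem two_ne_zero_of_ringChar (h : ringChar K ≠ 2) : (2 : L) ≠ 0 := by
  have : (2 : K) ≠ 0 := Ring.two_ne_zero h
  intro h2
  apply this
  apply (algebraMap K L).injective
  rw [map_ofNat, h2, map_zero]

theorem ringChar_ne_two (h : (2 : L) ≠ 0) : ringChar L ≠ 2 := by
  intro h2
  apply h
  have := ringChar.Nat.cast_ringChar (R := L)
  rw [h2] at this
  exact_mod_cast this

theorem traceSqCount_add_nonsquare (hK : ringChar K ≠ 2) (hodd : Odd (Module.finrank K L))
    {z : K} (hz : ¬ IsSquare z) (s : K) :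
    (traceSqCount K L (z * s) + traceSqCount K L s) * Fintype.card K = 2 * Fintype.card L := by
  have h := card_sq_add_card_mul_sq (ringChar_ne_two (two_ne_zero_of_ringChar hK))
    (not_isSquare_algebraMap (L := L) hodd hz) fun u => Algebra.trace K L u = z * s
  have hz0 : z ≠ 0 := by rintro rfl; exact hz (IsSquare.zero)
  rw [← card_trace_eq_mul (L := L) (z * s), ← mul_assoc, ← h]
  congr 2
  rw [traceSqCount]
  congr 1
  ext y
  simp only [Finset.mem_filter, Finset.mem_univ, true_and]
  rw [← Algebra.smul_def, map_smul, smul_eq_mul, mul_right_inj' hz0]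

/-- The count is constant on nonzero squares, and its values at `s` and at `z s`, for a nonsquare
`z`, add up to twice the mean. So one deviation `δ` describes it, and the second moment gives `δ ^
2`. The sign of `δ` can stay open, since the weight distribution is symmetric in it. -/
theorem traceSqCount_of_odd (hK : ringChar K ≠ 2) {k : ℕ} (hk : Module.finrank K L = 2 * k + 1) :
    ∃ δ : ℤ, (δ = (Fintype.card K : ℤ) ^ k ∨ δ = -(Fintype.card K : ℤ) ^ k) ∧
      ∀ s : K, (traceSqCount K L s : ℤ) = (Fintype.card K : ℤ) ^ (2 * k) + quadraticChar K s * δ := by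
  classical
  have hodd : Odd (Module.finrank K L) := ⟨k, hk⟩
  have hL : Fintype.card L = Fintype.card K ^ (2 * k + 1) := by
    rw [Module.card_eq_pow_finrank (K := K), hk]
  have hq : 1 < Fintype.card K := Fintype.one_lt_card
  have hq1 : (1 : ℤ) < Fintype.card K := by exact_mod_cast hq
  have hadd : ∀ {z : K}, ¬ IsSquare z → ∀ s : K,
      traceSqCount K L (z * s) + traceSqCount K L s = 2 * Fintype.card K ^ (2 * k) := by
    intro z hz s
    have := traceSqCount_add_nonsquare (L := L) hK hodd hz s
    rw [hL, pow_succ, ← mul_assoc] at this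
    exact Nat.eq_of_mul_eq_mul_right (by omega) this
  obtain ⟨z, hz⟩ := FiniteField.exists_nonsquare hK
  have h0 : traceSqCount K L (0 : K) = Fintype.card K ^ (2 * k) := by
    have := hadd hz 0
    rw [mul_zero] at this
    omega
  set δ : ℤ := (traceSqCount K L (1 : K) : ℤ) - (Fintype.card K : ℤ) ^ (2 * k) with hδ
  have hZ : ∀ s : K, (traceSqCount K L s : ℤ)
      = (Fintype.card K : ℤ) ^ (2 * k) + quadraticChar K s * δ := by
    intro s
    by_cases hs : s = 0
    · simp [hs, h0]
    by_cases hsq : IsSquare s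
    · rw [(quadraticChar_one_iff_isSquare hs).2 hsq]
      obtain ⟨w, rfl⟩ := hsq
      have hw : algebraMap K L w ≠ 0 := by
        rw [Ne, map_eq_zero]; rintro rfl; exact hs (by simp)
      have := traceSqCount_mul_sq (K := K) hw (s := 1) (u := w * w) (by simp [sq])
      rw [mul_one] at this
      rw [this]; ring
    · rw [quadraticChar_neg_one_iff_not_isSquare.2 hsq]
      have := hadd hsq 1
      rw [mul_one] at this
      zify at this
      linarith
  refine ⟨δ, ?_, hZ⟩
  have h2 := sum_traceSqCount_sq (K := K) (L := L) (two_ne_zero_of_ringChar hK)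
  -- The cross term of the square vanishes because the quadratic character sums to zero.
  have h3 : ((∑ s : K, traceSqCount K L s ^ 2 : ℕ) : ℤ)
      = Fintype.card K * (Fintype.card K : ℤ) ^ (4 * k) + (Fintype.card K - 1) * δ ^ 2 := by
    push_cast
    rw [Finset.sum_congr rfl fun s _ => by rw [hZ s]]
    have hsq : ∀ s : K, ((quadraticChar K s : ℤ)) ^ 2 = if s = 0 then 0 else 1 := by
      intro s
      split_ifs with h
      · simp [h]
      · exact quadraticChar_sq_one h
    have : ∀ s : K, ((Fintype.card K : ℤ) ^ (2 * k) + quadraticChar K s * δ) ^ 2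
        = (Fintype.card K : ℤ) ^ (4 * k) + quadraticChar K s * (2 * (Fintype.card K : ℤ) ^ (2 * k) * δ)
          + (1 - if s = 0 then 1 else 0) * δ ^ 2 := by
      intro s
      have h := hsq s
      have h' : (1 - if s = 0 then (1 : ℤ) else 0) = if s = 0 then 0 else 1 := by
        split_ifs <;> rfl
      rw [h', ← h]
      ring
    simp_rw [this]
    rw [Finset.sum_add_distrib, Finset.sum_add_distrib, ← Finset.sum_mul, ← Finset.sum_mul,
      quadraticChar_sum_zero hK, Finset.sum_sub_distrib]
    simp
  zify at h2
  push_cast at h3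
  rw [h3, Nat.cast_sub Fintype.card_pos, hL] at h2
  push_cast at h2
  set Q : ℤ := (Fintype.card K : ℤ)
  have h4 : (Q - 1) * Q * (δ ^ 2) = (Q - 1) * Q * (Q ^ k) ^ 2 := by
    linear_combination h2
  have h5 := mul_left_cancel₀ (mul_ne_zero (by omega) (by omega)) h4
  exact sq_eq_sq_iff_eq_or_eq_neg.1 h5

theorem odd_card_of_ringChar (hK : ringChar K ≠ 2) : Odd (Fintype.card K) :=
  Nat.odd_iff.2 (FiniteField.odd_card_of_char_ne_two hK)

theorem trace_quadratic (h : Module.finrank K L = 2) (x : L) :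
    algebraMap K L (Algebra.trace K L x) = x + x ^ Fintype.card K := by
  rw [FiniteField.algebraMap_trace_eq_sum_pow, h, Nat.card_eq_fintype_card]
  simp [Finset.sum_range_succ]

/-- With `#K = 2 j + 1`, `Tr (y ^ 2) = y ^ 2 (1 + y ^ (4 j))`, and `Lˣ` is cyclic of order `4 j (j +
1)`. So a nonzero solution means `y ^ (4 j) = -1`, which is possible exactly for odd `j`. -/
theorem traceSqCount_zero_ne_one_iff (hK : ringChar K ≠ 2) (h : Module.finrank K L = 2) :
    traceSqCount K L (0 : K) ≠ 1 ↔ Fintype.card K % 4 = 3 := by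
  classical
  have hLc : Fintype.card L = Fintype.card K ^ 2 := by rw [Module.card_eq_pow_finrank (K := K), h]
  obtain ⟨j, hj⟩ := odd_card_of_ringChar hK
  have h2L : (2 : L) ≠ 0 := two_ne_zero_of_ringChar hK
  have hneg : (-1 : L) ≠ 1 := Ring.neg_one_ne_one_of_char_ne_two (ringChar_ne_two h2L)
  have hmem : ∀ y : L, y ≠ 0 → (Algebra.trace K L (y ^ 2) = 0 ↔ y ^ (4 * j) = -1) := by
    intro y hy
    have h1 : Algebra.trace K L (y ^ 2) = 0 ↔ y ^ 2 * (1 + y ^ (4 * j)) = 0 := by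
      rw [← map_eq_zero (algebraMap K L), trace_quadratic h, hj]
      ring_nf
    rw [h1, mul_eq_zero, or_iff_right (pow_ne_zero 2 hy)]
    constructor
    · intro h; linear_combination h
    · intro h; rw [h]; ring
  have hcard : ∀ y : L, y ≠ 0 → y ^ (4 * j * (j + 1)) = 1 := by
    intro y hy
    have := FiniteField.pow_card_sub_one_eq_one y hy
    rwa [hLc, hj, show (2 * j + 1) ^ 2 - 1 = 4 * j * (j + 1) by
      rw [Nat.sub_eq_iff_eq_add (Nat.one_le_pow _ _ (by omega))]; ring] at this
  have hne : traceSqCount K L (0 : K) ≠ 1 ↔ ∃ y : L, y ≠ 0 ∧ Algebra.trace K L (y ^ 2) = 0 := by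
    rw [traceSqCount, Ne, Finset.card_eq_one]
    constructor
    · intro hn
      by_contra! hcon
      refine hn ⟨0, ?_⟩
      ext y
      simp only [Finset.mem_filter, Finset.mem_univ, true_and, Finset.mem_singleton]
      constructor
      · intro hy; by_contra h0; exact hcon y h0 hy
      · rintro rfl; simp
    · rintro ⟨y, hy, hy2⟩ ⟨a, ha⟩
      have m1 : y ∈ ({a} : Finset L) := by rw [← ha]; simp [hy2]
      have m2 : (0 : L) ∈ ({a} : Finset L) := by rw [← ha]; simp
      rw [Finset.mem_singleton] at m1 m2
      exact hy (m1.trans m2.symm)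
  rw [hne]
  constructor
  · rintro ⟨y, hy, hy2⟩
    have h1 := (hmem y hy).1 hy2
    have h2 := hcard y hy
    rw [pow_mul, h1] at h2
    have : Even (j + 1) := by
      by_contra hodd
      rw [Nat.not_even_iff_odd] at hodd
      exact hneg (hodd.neg_one_pow.symm.trans h2)
    rw [hj]
    obtain ⟨i, hi⟩ := this
    omega
  · intro h3
    obtain ⟨i, hi⟩ : ∃ i, j = 2 * i + 1 := ⟨j / 2, by omega⟩
    obtain ⟨g, hg⟩ := IsCyclic.exists_generator (α := Lˣ)
    have hord : orderOf g = Fintype.card L - 1 := by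
      rw [orderOf_eq_card_of_forall_mem_zpowers hg, Nat.card_eq_fintype_card,
        Fintype.card_units]
    have hg2 : (g : L) ^ (2 * j * (j + 1)) = -1 := by
      have h4 : ((g : L) ^ (2 * j * (j + 1))) ^ 2 = 1 := by
        rw [← pow_mul, ← hcard g g.ne_zero]; ring_nf
      rcases mul_self_eq_one_iff.1 ((sq _).symm.trans h4) with h5 | h5
      · exfalso
        have h6 : g ^ (2 * j * (j + 1)) = 1 := by ext; simpa using h5
        have h7 := orderOf_dvd_of_pow_eq_one h6
        rw [hord, hLc, hj, show (2 * j + 1) ^ 2 - 1 = 2 * (2 * j * (j + 1)) by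
          rw [Nat.sub_eq_iff_eq_add (Nat.one_le_pow _ _ (by omega))]; ring] at h7
        have h8 : 0 < 2 * j * (j + 1) := by subst hi; positivity
        have := Nat.le_of_dvd h8 h7
        omega
      · exact h5
    -- For `j = 2 i + 1` one has `2 j (j + 1) = 4 j (i + 1)`, so the `4 j`-th power of `g ^ (i + 1)`
    -- is `-1`.
    refine ⟨(g : L) ^ (i + 1), pow_ne_zero _ g.ne_zero, ?_⟩
    rw [hmem _ (pow_ne_zero _ g.ne_zero), ← hg2, ← pow_mul]
    congr 1
    subst hi
    ring

/-- Euler's criterion in `L`: the exponent `(#L - 1) / 2` is a multiple of `#K - 1`. -/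
theorem isSquare_algebraMap_of_quadratic (hK : ringChar K ≠ 2) (h : Module.finrank K L = 2)
    (s : K) : IsSquare (algebraMap K L s) := by
  by_cases hs : s = 0
  · simp [hs]
  have hLc : Fintype.card L = Fintype.card K ^ 2 := by rw [Module.card_eq_pow_finrank (K := K), h]
  obtain ⟨j, hj⟩ := odd_card_of_ringChar hK
  rw [FiniteField.isSquare_iff (ringChar_ne_two (two_ne_zero_of_ringChar hK))
    (by simpa using hs), hLc, hj, show (2 * j + 1) ^ 2 / 2 = 2 * j * (j + 1) by
      rw [show (2 * j + 1) ^ 2 = 1 + 2 * (2 * j * (j + 1)) by ring,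
        Nat.add_mul_div_left _ _ (by norm_num)]; simp, ← map_pow, pow_mul]
  have := FiniteField.pow_card_sub_one_eq_one s hs
  rw [hj, Nat.add_sub_cancel] at this
  simp [this]

/-- Every element of `K` is a square in `L`, so only two values occur, `Z0` at `0` and `Z1`
elsewhere. The first two moments give `Z1 = #K ± 1`, and the sign is read off from whether `Z0 = 1`.
-/
theorem traceSqCount_of_quadratic (hK : ringChar K ≠ 2) (h : Module.finrank K L = 2) (s : K) :
    (traceSqCount K L s : ℤ) = Fintype.card K +
      (if Fintype.card K % 4 = 3 then 1 else -1) *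
        ((if s = 0 then (Fintype.card K : ℤ) else 0) - 1) := by
  have hLc : Fintype.card L = Fintype.card K ^ 2 := by rw [Module.card_eq_pow_finrank (K := K), h]
  have h1 : ∀ s : K, s ≠ 0 → traceSqCount K L s = traceSqCount K L (1 : K) := by
    intro s hs
    obtain ⟨w, hw⟩ := isSquare_algebraMap_of_quadratic (L := L) hK h s
    have hw0 : w ≠ 0 := by
      rintro rfl
      simp [hs] at hw
    rw [← traceSqCount_mul_sq (K := K) hw0 (s := 1) (u := s) (by rw [hw, sq]), mul_one]
  set Z0 : ℤ := (traceSqCount K L (0 : K) : ℤ) with hZ0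
  set Z1 : ℤ := (traceSqCount K L (1 : K) : ℤ) with hZ1
  set R : ℤ := (Fintype.card K : ℤ) with hR
  have hR1 : 1 < R := Nat.one_lt_cast.2 Fintype.one_lt_card
  have e1 : Z0 + (R - 1) * Z1 = R ^ 2 := by
    have := sum_traceSqCount (K := K) (L := L)
    rw [← Finset.add_sum_erase _ _ (Finset.mem_univ (0 : K)),
      Finset.sum_congr rfl fun s hs => h1 s (Finset.ne_of_mem_erase hs), hLc] at this
    simp only [Finset.sum_const, Finset.mem_univ, Finset.card_erase_of_mem, Finset.card_univ,
      smul_eq_mul] at this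
    zify [Fintype.card_pos (α := K)] at this
    exact this
  have e2 : (Z0 ^ 2 + (R - 1) * Z1 ^ 2) * R = R ^ 2 * R + (R ^ 2 - 1) * R ^ 2 := by
    have := sum_traceSqCount_sq (K := K) (L := L) (two_ne_zero_of_ringChar hK)
    rw [← Finset.add_sum_erase _ _ (Finset.mem_univ (0 : K)),
      Finset.sum_congr rfl fun s hs => by rw [h1 s (Finset.ne_of_mem_erase hs)], hLc] at this
    simp only [Finset.sum_const, Finset.mem_univ, Finset.card_erase_of_mem, Finset.card_univ,
      smul_eq_mul] at this
    zify [Fintype.card_pos (α := K), Nat.one_le_pow 2 _ (Fintype.card_pos (α := K))] at this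
    exact this
  have e3 : (Z1 - R) ^ 2 = 1 := by
    have h4 : (R - 1) * R * R * (Z1 - R) ^ 2 = (R - 1) * R * R * 1 := by
      have : Z0 = R ^ 2 - (R - 1) * Z1 := by linarith
      rw [this] at e2
      linear_combination e2
    exact mul_left_cancel₀ (mul_ne_zero (mul_ne_zero (by omega) (by omega)) (by omega)) h4
  have e4 := traceSqCount_zero_ne_one_iff (L := L) hK h
  have e5 : Z0 ≠ 1 ↔ Fintype.card K % 4 = 3 := by
    rw [← e4, hZ0]
    exact_mod_cast Iff.rfl
  have e6 : Z1 = R - (if Fintype.card K % 4 = 3 then 1 else -1) := by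
    rcases mul_self_eq_one_iff.1 ((sq _).symm.trans e3) with h5 | h5
    · have : Z0 = 1 := by
        have : Z1 = R + 1 := by linarith
        rw [this] at e1; linarith
      rw [if_neg (fun h => e5.2 h this)]; linarith
    · have : Z0 ≠ 1 := by
        have : Z1 = R - 1 := by linarith
        rw [this] at e1
        intro h0
        have : (R - 1) * (2 : ℤ) = 0 := by linear_combination h0 - e1
        rcases mul_eq_zero.1 this with h | h <;> omega
      rw [if_pos (e5.1 this)]; linarith
  by_cases hs : s = 0
  · rw [if_pos hs, hs, ← hZ0]
    rw [e6] at e1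
    linear_combination e1
  · rw [if_neg hs, h1 s hs, ← hZ1, e6]; ring

/-- The field fixed by the `k`-th power of Frobenius, an automorphism of order `2`. -/
theorem exists_intermediateField_finrank_two {k : ℕ} (hk : Module.finrank K L = 2 * k)
    (hk0 : 0 < k) : ∃ E : IntermediateField K L, Module.finrank E L = 2 := by
  let σ := FiniteField.frobeniusAlgEquivOfAlgebraic K L
  have hσ : orderOf σ = 2 * k := by
    rw [← hk]; exact FiniteField.orderOf_frobeniusAlgEquivOfAlgebraic K L
  refine ⟨IntermediateField.fixedField (Subgroup.zpowers (σ ^ k)), ?_⟩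
  rw [IntermediateField.finrank_fixedField_eq_card, Nat.card_zpowers,
    orderOf_pow_of_dvd hk0.ne' (by rw [hσ]; exact Dvd.intro_left _ rfl), hσ]
  exact Nat.mul_div_cancel _ hk0

/-- By transitivity of the trace, the count is the sum of the counts for `L` over `E` along the
fibre of `Tr` from `E` to `K` above `s`. This fibre has `#K ^ (k - 1)` elements and contains the
exceptional point `0` only for `s = 0`. -/
theorem traceSqCount_of_even (hK : ringChar K ≠ 2) {k : ℕ} (hk : Module.finrank K L = 2 * k)
    (hk0 : 0 < k) (s : K) :
    (traceSqCount K L s : ℤ) = (Fintype.card K : ℤ) ^ (2 * k - 1) +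
      (if Fintype.card K ^ k % 4 = 3 then 1 else -1) *
        ((if s = 0 then (Fintype.card K : ℤ) ^ k else 0) - (Fintype.card K : ℤ) ^ (k - 1)) := by
  classical
  obtain ⟨E, hE⟩ := exists_intermediateField_finrank_two hk hk0
  have hKE : Module.finrank K E = k := by
    have := Module.finrank_mul_finrank K E L
    rw [hE, hk] at this
    omega
  have : Fintype E := Fintype.ofFinite E
  have hEc : Fintype.card E = Fintype.card K ^ k := by
    rw [Module.card_eq_pow_finrank (K := K), hKE]
  have hEchar : ringChar E ≠ 2 := ringChar_ne_two (two_ne_zero_of_ringChar hK)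
  have e1 : traceSqCount K L s =
      ∑ e : E with Algebra.trace K E e = s, traceSqCount E L e := by
    rw [traceSqCount, Finset.card_eq_sum_card_fiberwise (f := fun y : L => Algebra.trace E L (y ^ 2))
      (t := Finset.univ.filter fun e : E => Algebra.trace K E e = s)]
    · refine Finset.sum_congr rfl fun e he => ?_
      rw [traceSqCount]
      congr 1
      ext y
      simp only [Finset.mem_filter, Finset.mem_univ, true_and] at he ⊢
      rw [← Algebra.trace_trace (S := E)]
      exact ⟨fun h => h.2, fun h => ⟨h ▸ he, h⟩⟩
    · intro y hy
      simp only [Finset.coe_filter, Finset.mem_univ, true_and, Set.mem_ofPred_eq] at hy ⊢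
      rw [Algebra.trace_trace]
      exact hy
  have e2 : (Finset.univ.filter fun e : E => Algebra.trace K E e = s).card
      = Fintype.card K ^ (k - 1) := by
    have := card_trace_eq_mul (L := E) s
    rw [hEc] at this
    obtain ⟨j, rfl⟩ : ∃ j, k = j + 1 := ⟨k - 1, by omega⟩
    rw [pow_succ] at this
    exact Nat.eq_of_mul_eq_mul_right Fintype.card_pos this
  rw [e1]
  push_cast
  rw [Finset.sum_congr rfl fun e _ => traceSqCount_of_quadratic (L := L) hEchar hE e,
    Finset.sum_add_distrib, ← Finset.mul_sum, Finset.sum_sub_distrib, Finset.sum_const,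
    Finset.sum_const, e2, hEc, Finset.sum_ite_eq']
  have e3 : ((0 : E) ∈ Finset.univ.filter fun e : E => Algebra.trace K E e = s) ↔ s = 0 := by
    simp [eq_comm]
  simp only [e3]
  obtain ⟨j, rfl⟩ : ∃ j, k = j + 1 := ⟨k - 1, by omega⟩
  rw [show 2 * (j + 1) - 1 = j + (j + 1) by omega]
  push_cast
  simp only [nsmul_eq_mul]
  push_cast
  ring

end OddCharacteristic

/-! ### Subfield codes in terms of linear functionals -/

section SubfieldCodes

variable {K L : Type*} [Field K] [Field L] [Algebra K L]

/-- The coordinates for `B` span all functionals, and multiplication by a scalar of `L` only changes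
the functional. The right-hand side involves neither the basis nor the choice of generator matrix,
so the subfield code depends on the row space alone. -/
theorem subfieldCode_eq_span {κ r ι : Type*} [Fintype κ] (B : Module.Basis κ K L)
    (G : Matrix r ι L) :
    subfieldCode B G = Submodule.span K
      {c : ι → K | ∃ φ : L →ₗ[K] K, ∃ w ∈ rowCode G, c = fun j => φ (w j)} := by
  apply le_antisymm
  · refine Submodule.span_le.2 ?_
    rintro _ ⟨⟨i, k⟩, rfl⟩
    exact Submodule.subset_span ⟨B.coord k, G.row i, Submodule.subset_span ⟨i, rfl⟩, rfl⟩
  · refine Submodule.span_le.2 ?_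
    rintro _ ⟨φ, w, hw, rfl⟩
    simp only [SetLike.mem_coe]
    revert φ
    refine Submodule.span_induction (p := fun w _ => ∀ φ : L →ₗ[K] K,
      (fun j => φ (w j)) ∈ subfieldCode B G) ?_ ?_ ?_ ?_ hw
    · rintro _ ⟨i, rfl⟩ φ
      have : (fun j => φ (G.row i j)) = ∑ k, φ (B k) • (expandMatrix B G).row (i, k) := by
        ext j
        conv_lhs => rw [← B.sum_repr (G.row i j), map_sum]
        simp [expandMatrix, Matrix.row, mul_comm]
      rw [this]
      exact Submodule.sum_mem _ fun k _ => Submodule.smul_mem _ _ (Submodule.subset_span ⟨_, rfl⟩)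
    · intro φ
      have : (fun j => φ ((0 : ι → L) j)) = 0 := by ext; simp
      rw [this]
      exact Submodule.zero_mem _
    · intro x y _ _ hx hy φ
      simpa only [Pi.add_apply, map_add] using! Submodule.add_mem _ (hx φ) (hy φ)
    · intro a x _ hx φ
      -- The scalar `a` of `L` is absorbed into the functional.
      exact hx (φ.comp (LinearMap.mulLeft K a))

variable (K) in
/-- The map sending `(t, b, c)` to the vector of the values `t + Tr (b x) + Tr (c y)` at the points
`(x, y)` of `D`. -/
noncomputable def traceEval (D : Finset (L × L)) : (K × L × L) →ₗ[K] (D → K) where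
  toFun τ := fun P => τ.1 + Algebra.trace K L (τ.2.1 * P.1.1) + Algebra.trace K L (τ.2.2 * P.1.2)
  map_add' := by
    intro τ τ'
    ext P
    simp only [Prod.fst_add, Prod.snd_add, add_mul, map_add, Pi.add_apply]
    ring
  map_smul' := by
    intro a τ
    ext P
    simp only [Prod.smul_fst, Prod.smul_snd, smul_mul_assoc, map_smul, Pi.smul_apply, smul_eq_mul,
      RingHom.id_apply]
    ring

theorem traceEval_apply (D : Finset (L × L)) (t : K) (b c : L) (P : D) :
    traceEval K D (t, b, c) P
      = t + Algebra.trace K L (b * P.1.1) + Algebra.trace K L (c * P.1.2) := rfl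

variable [Fintype K] [DecidableEq K] [Fintype L]

theorem mem_codeFG_iff (f g : L → K) (w : Option (solutionSet f g) → L) :
    w ∈ codeFG f g ↔ ∃ a b c : L, w none = b ∧ ∀ P : solutionSet f g,
      w (some P) = a + b * P.1.1 + c * P.1.2 := by
  have h : w ∈ codeFG f g ↔ ∃ v : Fin 3 → L, ∑ i, v i • (genMatrix f g).row i = w := by
    rw [codeFG, rowCode]
    exact Submodule.mem_span_range_iff_exists_fun L
  rw [h]
  constructor
  · rintro ⟨v, rfl⟩
    refine ⟨v 0, v 1, v 2, ?_, fun P => ?_⟩ <;>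
      simp [Fin.sum_univ_three, genMatrix, Matrix.row]
  · rintro ⟨a, b, c, h0, h1⟩
    refine ⟨![a, b, c], ?_⟩
    ext j
    rcases j with _ | P
    · simp [Fin.sum_univ_three, genMatrix, Matrix.row, h0]
    · simp [Fin.sum_univ_three, genMatrix, Matrix.row, h1]

/-- A functional has the form `Tr (β ·)`, so applying it to `a + b x + c y` gives the triple `(φ a,
β b, β c)`. Conversely the trace itself reaches every triple, as it is onto `K`. -/
theorem punctureFirst_subfieldCode_eq_range {κ r : Type*} [Fintype κ] (B : Module.Basis κ K L)
    (f g : L → K) (G : Matrix r (Option (solutionSet f g)) L) (hG : rowCode G = codeFG f g) :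
    punctureFirst (subfieldCode B G) = LinearMap.range (traceEval K (solutionSet f g)) := by
  rw [subfieldCode_eq_span, punctureFirst, Submodule.map_span, hG]
  apply le_antisymm
  · refine Submodule.span_le.2 ?_
    rintro _ ⟨_, ⟨φ, w, hw, rfl⟩, rfl⟩
    obtain ⟨a, b, c, -, h⟩ := (mem_codeFG_iff f g w).1 hw
    obtain ⟨β, hβ⟩ := exists_trace_mul_eq φ
    refine ⟨(φ a, β * b, β * c), ?_⟩
    ext P
    simp only [LinearMap.funLeft_apply, h, traceEval_apply, hβ, mul_add, map_add, mul_assoc]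
  · rintro _ ⟨⟨t, b, c⟩, rfl⟩
    obtain ⟨a, ha⟩ := Algebra.trace_surjective K L t
    refine Submodule.subset_span ⟨fun j => Algebra.trace K L
      (Option.elim j b fun P => a + b * P.1.1 + c * P.1.2), ⟨Algebra.trace K L,
        fun j => Option.elim j b fun P => a + b * P.1.1 + c * P.1.2, ?_, rfl⟩, ?_⟩
    · rw [mem_codeFG_iff]
      exact ⟨a, b, c, rfl, fun P => rfl⟩
    · ext P
      simp [LinearMap.funLeft_apply, traceEval_apply, ha]

end SubfieldCodes

/-! ### Counting zeros of codewords -/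

section Zeros

variable {K L : Type*} [Field K] [Fintype K] [DecidableEq K] [Field L] [Fintype L] [Algebra K L]

variable (K L) in
/-- The set of all `(x, y)` with `Tr x + Tr (y ^ 2) = 0`. -/
noncomputable abbrev traceSet : Finset (L × L) :=
  solutionSet (fun x => Algebra.trace K L x) fun y => Algebra.trace K L (y ^ 2)

theorem mem_traceSet {P : L × L} :
    P ∈ traceSet K L ↔ Algebra.trace K L P.1 + Algebra.trace K L (P.2 ^ 2) = 0 := by
  simp [solutionSet]

variable (K) in
open Finset in
/-- The number of zeros of the codeword `(t, b, c)`. -/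
noncomputable def zeroCount (t : K) (b c : L) : ℕ :=
  #{P ∈ traceSet K L | t + Algebra.trace K L (b * P.1) + Algebra.trace K L (c * P.2) = 0}

open Finset in
theorem hammingNorm_traceEval (t : K) (b c : L) :
    (hammingNorm (traceEval K (traceSet K L) (t, b, c)) : ℤ)
      = #(traceSet K L) - zeroCount K t b c := by
  have h1 := Finset.card_filter_add_card_filter_not (s := (univ : Finset (traceSet K L)))
    (fun P => traceEval K (traceSet K L) (t, b, c) P = 0)
  have h2 : #{P : traceSet K L | traceEval K (traceSet K L) (t, b, c) P = 0}
      = zeroCount K t b c := by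
    refine Finset.card_bij (fun P _ => P) ?_ ?_ ?_
    · intro P hP
      exact mem_filter.2 ⟨P.2, (mem_filter.1 hP).2⟩
    · intro P _ P' _ h
      exact Subtype.ext h
    · intro P hP
      rw [mem_filter] at hP
      exact ⟨⟨P, hP.1⟩, mem_filter.2 ⟨mem_univ _, hP.2⟩, rfl⟩
  rw [h2, card_univ, Fintype.card_coe] at h1
  rw [hammingNorm]
  zify at h1
  simp only [ne_eq]
  linarith

open Finset in
theorem zeroCount_eq_sum (t : K) (b c : L) : zeroCount K t b c =
    ∑ y : L, #{x : L | Algebra.trace K L x = -Algebra.trace K L (y ^ 2) ∧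
      Algebra.trace K L (b * x) = -(t + Algebra.trace K L (c * y))} := by
  classical
  rw [zeroCount, Finset.card_eq_sum_card_fiberwise (f := Prod.snd) (t := univ) (by simp)]
  refine Finset.sum_congr rfl fun y _ => ?_
  refine Finset.card_bij' (fun P _ => P.1) (fun x _ => (x, y)) ?_ ?_ ?_ ?_
  · rintro ⟨a, d⟩ h
    simp only [mem_filter, mem_univ, true_and, mem_traceSet] at h ⊢
    obtain ⟨⟨h1, h2⟩, rfl⟩ := h
    exact ⟨by linear_combination h1, by linear_combination h2⟩
  · intro x h
    simp only [mem_filter, mem_univ, true_and, mem_traceSet] at h ⊢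
    exact ⟨⟨by linear_combination h.1, by linear_combination h.2⟩, trivial⟩
  · rintro ⟨a, d⟩ h
    rw [← (mem_filter.1 h).2]
  · intro x _; rfl

theorem card_eq_pow {m : ℕ} (hm : Module.finrank K L = m) :
    Fintype.card L = Fintype.card K ^ m := by
  rw [Module.card_eq_pow_finrank (K := K), hm]

/-- For each `y` the two conditions prescribe `Tr x` and `Tr (b x)`, which are independent
functionals. -/
theorem zeroCount_of_notMem {m : ℕ} (hm : Module.finrank K L = m) (hm2 : 2 ≤ m) (t : K) {b : L}
    (c : L) (hb : b ∉ Set.range (algebraMap K L)) :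
    zeroCount K t b c = Fintype.card K ^ (2 * m - 2) := by
  obtain ⟨k, rfl⟩ : ∃ k, m = k + 2 := ⟨m - 2, by omega⟩
  have h : ∀ u v : K, (Finset.univ.filter fun x : L => Algebra.trace K L x = u ∧
      Algebra.trace K L (b * x) = v).card = Fintype.card K ^ k := by
    intro u v
    have := card_trace_prod_eq_mul hb u v
    rw [card_eq_pow hm, pow_add] at this
    exact Nat.eq_of_mul_eq_mul_right (pow_pos Fintype.card_pos 2) this
  rw [zeroCount_eq_sum, Finset.sum_congr rfl fun y _ => h _ _, Finset.sum_const, Finset.card_univ,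
    card_eq_pow hm, smul_eq_mul, ← pow_add]
  congr 1
  omega

open Finset in
-- On `D`, `Tr (β x) = -β Tr (y ^ 2)`, so vanishing is a condition on `y` alone; each admissible `y`
-- comes with all the `x` of prescribed trace.
theorem zeroCount_algebraMap {m : ℕ} (hm : Module.finrank K L = m) (hm2 : 1 ≤ m) (t β : K) (c : L) :
    zeroCount K t (algebraMap K L β) c = Fintype.card K ^ (m - 1) *
      #{y : L | t + Algebra.trace K L (c * y) = β * Algebra.trace K L (y ^ 2)} := by
  obtain ⟨k, rfl⟩ : ∃ k, m = k + 1 := ⟨m - 1, by omega⟩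
  have h : ∀ u : K, #{x : L | Algebra.trace K L x = u} = Fintype.card K ^ k := by
    intro u
    have := card_trace_eq_mul (L := L) u
    rw [card_eq_pow hm, pow_add, pow_one] at this
    exact Nat.eq_of_mul_eq_mul_right Fintype.card_pos this
  rw [zeroCount_eq_sum, Finset.card_filter, Finset.mul_sum]
  refine Finset.sum_congr rfl fun y _ => ?_
  simp only [← Algebra.smul_def, map_smul, smul_eq_mul]
  split_ifs with h1
  · rw [mul_one, Nat.add_sub_cancel, ← h (-Algebra.trace K L (y ^ 2))]
    congr 1
    ext x
    simp only [mem_filter, mem_univ, true_and, and_iff_left_iff_imp]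
    intro hx
    rw [hx, h1]
    ring
  · rw [mul_zero, Finset.card_eq_zero, Finset.filter_eq_empty_iff]
    rintro x - ⟨hx, hx2⟩
    apply h1
    rw [hx] at hx2
    linear_combination hx2

theorem card_traceSet {m : ℕ} (hm : Module.finrank K L = m) (hm2 : 1 ≤ m) :
    (traceSet K L).card = Fintype.card K ^ (2 * m - 1) := by
  have h := zeroCount_algebraMap (L := L) hm hm2 (0 : K) 0 0
  simp only [zeroCount, map_zero, zero_mul, add_zero, Finset.filter_true, Finset.card_univ,
    card_eq_pow hm] at h
  rw [h, ← pow_add]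
  congr 1
  omega

theorem weight_of_notMem {m : ℕ} (hm : Module.finrank K L = m) (hm2 : 2 ≤ m) (t : K) {b : L}
    (c : L) (hb : b ∉ Set.range (algebraMap K L)) :
    (hammingNorm (traceEval K (traceSet K L) (t, b, c)) : ℤ)
      = ((Fintype.card K : ℤ) - 1) * (Fintype.card K : ℤ) ^ (2 * m - 2) := by
  rw [hammingNorm_traceEval, zeroCount_of_notMem hm hm2 t c hb, card_traceSet hm (by omega),
    show 2 * m - 1 = (2 * m - 2) + 1 by omega]
  push_cast
  ring

open Finset in
theorem weight_algebraMap {m : ℕ} (hm : Module.finrank K L = m) (hm2 : 1 ≤ m) (t β : K) (c : L) :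
    (hammingNorm (traceEval K (traceSet K L) (t, algebraMap K L β, c)) : ℤ)
      = (Fintype.card K : ℤ) ^ (m - 1) * ((Fintype.card K : ℤ) ^ m -
        #{y : L | t + Algebra.trace K L (c * y) = β * Algebra.trace K L (y ^ 2)}) := by
  rw [hammingNorm_traceEval, zeroCount_algebraMap hm hm2, card_traceSet hm hm2,
    show 2 * m - 1 = (m - 1) + m by omega]
  push_cast
  ring

theorem weight_zero_zero {m : ℕ} (hm : Module.finrank K L = m) (hm2 : 1 ≤ m) (t : K) :
    (hammingNorm (traceEval K (traceSet K L) (t, 0, 0)) : ℤ)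
      = if t = 0 then 0 else (Fintype.card K : ℤ) ^ (2 * m - 1) := by
  have h := weight_algebraMap (L := L) hm hm2 t 0 0
  rw [map_zero] at h
  rw [h, show 2 * m - 1 = (m - 1) + m by omega, pow_add]
  split_ifs with h0
  · simp [h0, card_eq_pow hm]
  · simp [h0]

theorem weight_zero_left {m : ℕ} (hm : Module.finrank K L = m) (hm2 : 1 ≤ m) (t : K) {c : L}
    (hc : c ≠ 0) :
    (hammingNorm (traceEval K (traceSet K L) (t, 0, c)) : ℤ)
      = ((Fintype.card K : ℤ) - 1) * (Fintype.card K : ℤ) ^ (2 * m - 2) := by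
  have h := weight_algebraMap (L := L) hm hm2 t 0 c
  rw [map_zero] at h
  have h2 := card_trace_mul_eq_mul hc (-t)
  have h3 : (Finset.univ.filter fun y : L => t + Algebra.trace K L (c * y)
      = 0 * Algebra.trace K L (y ^ 2)).card = Fintype.card K ^ (m - 1) := by
    rw [card_eq_pow hm, ← Nat.sub_add_cancel hm2, pow_succ] at h2
    rw [← Nat.eq_of_mul_eq_mul_right Fintype.card_pos h2]
    congr 1
    ext y
    simp only [Finset.mem_filter, Finset.mem_univ, true_and, zero_mul]
    rw [add_comm, add_eq_zero_iff_eq_neg]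
  rw [h, h3]
  obtain ⟨k, rfl⟩ : ∃ k, m = k + 1 := ⟨m - 1, by omega⟩
  rw [show 2 * (k + 1) - 2 = k + k by omega]
  push_cast
  ring

end Zeros

/-! ### Weight distributions -/

section WeightDistributions

variable {F : Type*} [Field F] [DecidableEq F] {ι : Type*} [Fintype ι]

theorem hammingDist_eq_hammingNorm_sub (u v : ι → F) : hammingDist u v = hammingNorm (u - v) := by
  rw [hammingDist_comm, hammingDist_eq_hammingNorm, neg_add_eq_sub]

theorem weightCount_ne_zero_iff [Finite F] (C : Submodule F (ι → F)) (w : ℕ) :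
    weightCount C w ≠ 0 ↔ ∃ c ∈ C, hammingNorm c = w := by
  rw [weightCount, Ne, Set.ncard_eq_zero (Set.toFinite _), ← Ne, ← Set.nonempty_iff_ne_empty]
  rfl

theorem hasMinDist_of_weightCount [Finite F] {C : Submodule F (ι → F)} {d : ℕ}
    (hd : weightCount C d ≠ 0) (hd0 : d ≠ 0)
    (h : ∀ w, weightCount C w ≠ 0 → w ≠ 0 → d ≤ w) : HasMinDist C d := by
  constructor
  · obtain ⟨c, hc, hcd⟩ := (weightCount_ne_zero_iff C d).1 hd
    refine ⟨c, hc, 0, C.zero_mem, ?_, by rw [hammingDist_zero_right, hcd]⟩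
    rintro rfl
    exact hd0 (by simpa using hcd.symm)
  · rintro e ⟨u, hu, v, hv, hne, rfl⟩
    rw [hammingDist_eq_hammingNorm_sub]
    refine h _ ((weightCount_ne_zero_iff C _).2 ⟨u - v, C.sub_mem hu hv, rfl⟩) ?_
    rwa [Ne, hammingNorm_eq_zero, sub_eq_zero]

theorem hasMinDist_iff {C : Submodule F (ι → F)} {d : ℕ} :
    HasMinDist C d ↔ (∃ c ∈ C, c ≠ 0 ∧ hammingNorm c = d) ∧
      ∀ c ∈ C, c ≠ 0 → d ≤ hammingNorm c := by
  constructor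
  · rintro ⟨⟨u, hu, v, hv, hne, h⟩, hl⟩
    refine ⟨⟨u - v, C.sub_mem hu hv, sub_ne_zero.2 hne, by rw [← hammingDist_eq_hammingNorm_sub, h]⟩,
      fun c hc h0 => hl ⟨c, hc, 0, C.zero_mem, h0, by rw [hammingDist_zero_right]⟩⟩
  · rintro ⟨⟨c, hc, h0, h⟩, hl⟩
    refine ⟨⟨c, hc, 0, C.zero_mem, h0, by rw [hammingDist_zero_right, h]⟩, ?_⟩
    rintro e ⟨u, hu, v, hv, hne, rfl⟩
    rw [hammingDist_eq_hammingNorm_sub]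
    exact hl _ (C.sub_mem hu hv) (sub_ne_zero.2 hne)

theorem List.sum_map_ite_eq_zero {table : List (ℤ × ℚ)} {z : ℤ} (h : ∀ r ∈ table, r.1 ≠ z) :
    (table.map fun r => if r.1 = z then r.2 else 0).sum = 0 := by
  apply List.sum_eq_zero
  intro x hx
  obtain ⟨r, hr, rfl⟩ := List.mem_map.1 hx
  exact if_neg (h r hr)

theorem List.sum_map_ite_eq_of_mem {table : List (ℤ × ℚ)} (hnd : (table.map Prod.fst).Nodup)
    {r : ℤ × ℚ} (hr : r ∈ table) :
    (table.map fun s => if s.1 = r.1 then s.2 else 0).sum = r.2 := by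
  induction table with
  | nil => simp at hr
  | cons a l ih =>
    rw [List.map_cons, List.nodup_cons] at hnd
    rw [List.map_cons, List.sum_cons]
    rcases List.mem_cons.1 hr with rfl | hr
    · rw [if_pos rfl, List.sum_map_ite_eq_zero, add_zero]
      intro s hs h
      exact hnd.1 (List.mem_map.2 ⟨s, hs, h⟩)
    · rw [ih hnd.2 hr, if_neg, zero_add]
      intro h
      exact hnd.1 (List.mem_map.2 ⟨r, hr, h.symm⟩)

theorem HasWeightDistribution.weightCount_ne_zero_iff {C : Submodule F (ι → F)}
    {table : List (ℤ × ℚ)} (h : HasWeightDistribution C table)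
    (hnd : (table.map Prod.fst).Nodup) (hne : ∀ r ∈ table, r.2 ≠ 0) (w : ℕ) :
    weightCount C w ≠ 0 ↔ (w : ℤ) ∈ table.map Prod.fst := by
  rw [← Nat.cast_ne_zero (R := ℚ), h w]
  constructor
  · intro h0
    by_contra hcon
    exact h0 (List.sum_map_ite_eq_zero fun r hr hrw => hcon (List.mem_map.2 ⟨r, hr, hrw⟩))
  · intro hw
    obtain ⟨r, hr, hrw⟩ := List.mem_map.1 hw
    rw [← hrw, List.sum_map_ite_eq_of_mem hnd hr]
    exact hne r hr

/-- Distinct positive weights with nonzero multiplicities cannot merge or vanish, so each row other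
than that of the zero word contributes one weight. -/
theorem HasWeightDistribution.isWeightCode [Finite F] {C : Submodule F (ι → F)}
    {table : List (ℤ × ℚ)} (h : HasWeightDistribution C ((0, 1) :: table))
    (hnd : (table.map Prod.fst).Nodup) (hne : ∀ r ∈ table, r.2 ≠ 0) (hpos : ∀ r ∈ table, 0 < r.1) :
    IsWeightCode C table.length := by
  have hnd' : (((0, 1) :: table).map Prod.fst).Nodup := by
    rw [List.map_cons, List.nodup_cons]
    refine ⟨fun h0 => ?_, hnd⟩
    obtain ⟨r, hr, hr0⟩ := List.mem_map.1 h0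
    exact (hpos r hr).ne' hr0
  have hne' : ∀ r ∈ ((0, 1) :: table : List (ℤ × ℚ)), r.2 ≠ 0 := by
    intro r hr
    rcases List.mem_cons.1 hr with rfl | hr
    · exact one_ne_zero
    · exact hne r hr
  have hset : {w : ℕ | 1 ≤ w ∧ w ≤ Fintype.card ι ∧ weightCount C w ≠ 0} =
      (((table.map Prod.fst).toFinset.image Int.toNat : Finset ℕ) : Set ℕ) := by
    ext w
    simp only [Set.mem_ofPred_eq, Finset.coe_image, Set.mem_image, List.coe_toFinset,
      h.weightCount_ne_zero_iff hnd' hne', List.map_cons, List.mem_cons]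
    constructor
    · rintro ⟨h1, -, h2 | h2⟩
      · omega
      · exact ⟨w, h2, by simp⟩
    · rintro ⟨z, hz, rfl⟩
      obtain ⟨r, hr, rfl⟩ := List.mem_map.1 hz
      have hp := hpos r hr
      have hz' : ((r.1.toNat : ℕ) : ℤ) = r.1 := Int.toNat_of_nonneg hp.le
      refine ⟨by omega, ?_, Or.inr (by rw [hz']; exact hz)⟩
      -- The table does not bound its weights by the length; the bound comes from a codeword that
      -- attains the weight.
      have h0 : weightCount C r.1.toNat ≠ 0 := by
        rw [h.weightCount_ne_zero_iff hnd' hne', hz', List.map_cons]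
        exact List.mem_cons_of_mem _ hz
      obtain ⟨c, -, hc⟩ := (_root_.weightCount_ne_zero_iff C _).1 h0
      rw [← hc]
      exact hammingNorm_le_card_fintype
  rw [IsWeightCode, hset, Set.ncard_coe_finset, Finset.card_image_of_injOn,
    List.toFinset_card_of_nodup hnd, List.length_map]
  intro a ha b hb hab
  rw [List.coe_toFinset] at ha hb
  obtain ⟨r, hr, rfl⟩ := List.mem_map.1 ha
  obtain ⟨s, hs, rfl⟩ := List.mem_map.1 hb
  have := hpos r hr
  have := hpos s hs
  omega

theorem HasWeightDistribution.hasMinDist [Finite F] {C : Submodule F (ι → F)}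
    {table : List (ℤ × ℚ)} (h : HasWeightDistribution C ((0, 1) :: table))
    (hnd : (table.map Prod.fst).Nodup) (hne : ∀ r ∈ table, r.2 ≠ 0) (hpos : ∀ r ∈ table, 0 < r.1)
    {d : ℕ} (hd : (d : ℤ) ∈ table.map Prod.fst) (hmin : ∀ r ∈ table, (d : ℤ) ≤ r.1) :
    HasMinDist C d := by
  have hnd' : (((0, 1) :: table).map Prod.fst).Nodup := by
    rw [List.map_cons, List.nodup_cons]
    refine ⟨fun h0 => ?_, hnd⟩
    obtain ⟨r, hr, hr0⟩ := List.mem_map.1 h0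
    exact (hpos r hr).ne' hr0
  have hne' : ∀ r ∈ ((0, 1) :: table : List (ℤ × ℚ)), r.2 ≠ 0 := by
    intro r hr
    rcases List.mem_cons.1 hr with rfl | hr
    · exact one_ne_zero
    · exact hne r hr
  apply hasMinDist_of_weightCount
  · rw [h.weightCount_ne_zero_iff hnd' hne', List.map_cons]
    exact List.mem_cons_of_mem _ hd
  · obtain ⟨r, hr, hrd⟩ := List.mem_map.1 hd
    have := hpos r hr
    omega
  · intro w hw hw0
    rw [h.weightCount_ne_zero_iff hnd' hne', List.map_cons] at hw
    rcases List.mem_cons.1 hw with h0 | h1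
    · exact absurd (Nat.cast_eq_zero.1 h0) hw0
    · obtain ⟨r, hr, hrd⟩ := List.mem_map.1 h1
      have := hmin r hr
      omega

open Finset in
-- Fibres of `T` over its range are cosets of the kernel, and the kernel consists of the parameters
-- of weight `0`. Injectivity is not required, which is what the case `q = 2` needs.
theorem card_hammingNorm_eq_mul {V : Type*} [AddCommGroup V] [Module F V] [Fintype V] [Finite F]
    (T : V →ₗ[F] ι → F) (w : ℕ) :
    #{v | hammingNorm (T v) = w} =
      weightCount (LinearMap.range T) w * #{v | hammingNorm (T v) = 0} := by
  classical
  have := Fintype.ofFinite F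
  let s : Finset (ι → F) := {c | c ∈ LinearMap.range T ∧ hammingNorm c = w}
  have hs : weightCount (LinearMap.range T) w = #s := by
    rw [weightCount, ← Set.ncard_coe_finset]
    congr 1
    ext c
    simp [s]
  rw [hs, Finset.card_eq_sum_card_fiberwise (f := T) (t := s), ← smul_eq_mul, ← Finset.sum_const]
  · refine Finset.sum_congr rfl fun c hc => ?_
    obtain ⟨hc1, hc2⟩ := (mem_filter.1 hc).2
    have h := AddMonoidHom.card_fiber_eq_of_mem_range T.toAddMonoidHom (x := c) (y := 0) hc1
      ⟨0, map_zero _⟩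
    simp only [LinearMap.toAddMonoidHom_coe] at h
    simp only [hammingNorm_eq_zero]
    refine Eq.trans (congrArg _ ?_) h
    ext v
    simp only [mem_filter, mem_univ, true_and]
    refine ⟨fun h => mem_filter.2 ⟨mem_univ _, h.2⟩, fun h => ?_⟩
    have h' : T v = c := (mem_filter.1 h).2
    exact ⟨h' ▸ hc2, h'⟩
  · intro v hv
    simpa [s] using hv

open Finset in
theorem injective_of_card_hammingNorm_eq_zero {V : Type*} [AddCommGroup V] [Module F V] [Fintype V]
    (T : V →ₗ[F] ι → F) (hT : #{v | hammingNorm (T v) = 0} = 1) : Function.Injective T := by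
  rw [injective_iff_map_eq_zero]
  intro v hv
  exact Finset.card_le_one.1 hT.le v (by simp [hv]) 0 (by simp)

/-! ### Dual codes -/

theorem finrank_dualCode (C : Submodule F (ι → F)) :
    Module.finrank F (dualCode C) = Fintype.card ι - Module.finrank F C := by
  classical
  let B : LinearMap.BilinForm F (ι → F) := dotProductBilin F F
  have hB : B.Nondegenerate := by
    refine ⟨fun v hv => ?_, fun v hv => ?_⟩
    · exact dotProduct_eq_zero v hv
    · exact dotProduct_eq_zero v fun w => by rw [dotProduct_comm]; exact hv w
  have h := LinearMap.BilinForm.finrank_orthogonal hB C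
  rw [Module.finrank_fintype_fun_eq_card] at h
  rw [← h]
  have : dualCode C = B.orthogonal C := by
    ext x
    refine forall₂_congr fun c _ => ?_
    rw [dotProduct_comm]
    rfl
  rw [this]

end WeightDistributions

/-! ### Counting parameter triples by weight -/

section TraceCode

variable {K L : Type*} [Field K] [Fintype K] [DecidableEq K] [Field L] [Fintype L] [Algebra K L]

theorem finrank_range_traceEval {m : ℕ} (hm : Module.finrank K L = m) {D : Finset (L × L)}
    (hT : Function.Injective (traceEval K D)) :
    Module.finrank K (LinearMap.range (traceEval K D)) = 2 * m + 1 := by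
  rw [LinearMap.finrank_range_of_inj hT, Module.finrank_prod, Module.finrank_prod,
    Module.finrank_self, hm]
  omega

variable (K L) in
open Finset in
/-- The number of triples `(t, b, c)` whose codeword has weight `w`. -/
noncomputable def tripleCount (w : ℕ) : ℕ :=
  #{τ : K × L × L | hammingNorm (traceEval K (traceSet K L) τ) = w}

open Finset in
theorem tripleCount_eq_sum (w : ℕ) : tripleCount K L w =
    ∑ b : L, ∑ c : L, #{t : K | hammingNorm (traceEval K (traceSet K L) (t, b, c)) = w} := by
  simp only [tripleCount, Finset.card_filter, Fintype.sum_prod_type]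
  rw [Finset.sum_comm]
  refine Finset.sum_congr rfl fun b _ => ?_
  rw [Finset.sum_comm]

theorem sum_eq_of_cases (φ : L → ℚ) {A S : ℚ}
    (hA : ∀ b, b ∉ Set.range (algebraMap K L) → φ b = A)
    (hS : ∀ β : K, β ≠ 0 → φ (algebraMap K L β) = S) :
    ∑ b, φ b = ((Fintype.card L : ℚ) - Fintype.card K) * A + φ 0 + ((Fintype.card K : ℚ) - 1) * S := by
  classical
  let R : Finset L := Finset.univ.image (algebraMap K L)
  have hinj := (algebraMap K L).injective
  have h1 : ∑ b ∈ R, φ b = φ 0 + ((Fintype.card K : ℚ) - 1) * S := by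
    rw [Finset.sum_image hinj.injOn, ← Finset.add_sum_erase _ _ (Finset.mem_univ (0 : K)),
      Finset.sum_congr rfl fun β hβ => hS β (Finset.ne_of_mem_erase hβ), Finset.sum_const,
      Finset.card_erase_of_mem (Finset.mem_univ _), Finset.card_univ, nsmul_eq_mul,
      Nat.cast_sub Fintype.card_pos, map_zero, Nat.cast_one]
  have h2 : ∑ b ∈ Rᶜ, φ b = ((Fintype.card L : ℚ) - Fintype.card K) * A := by
    rw [Finset.sum_congr rfl fun b hb => hA b (by simpa [R] using hb), Finset.sum_const,
      Finset.card_compl, Finset.card_image_of_injective _ hinj, Finset.card_univ, nsmul_eq_mul,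
      Nat.cast_sub (Fintype.card_le_of_injective _ hinj)]
  rw [← Finset.sum_add_sum_compl R, h1, h2]
  ring

open Finset in
-- Collects what does not depend on the characteristic: `b ∉ K`, then `b = 0` with `c ≠ 0`, then `b
-- = c = 0`. The open part is a nonzero `β ∈ K`, assumed to contribute the same `S` for every `β`.
theorem tripleCount_eq {m : ℕ} (hm : Module.finrank K L = m) (hm2 : 2 ≤ m) (w : ℕ) {S : ℚ}
    (hS : ∀ β : K, β ≠ 0 → ((∑ c : L, #{t : K |
      hammingNorm (traceEval K (traceSet K L) (t, algebraMap K L β, c)) = w} : ℕ) : ℚ) = S) :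
    (tripleCount K L w : ℚ) =
      (if (0 : ℤ) = w then 1 else 0) +
      (if ((Fintype.card K : ℤ) - 1) * (Fintype.card K : ℤ) ^ (2 * m - 2) = w then
        (((Fintype.card K : ℚ) ^ m - Fintype.card K) * (Fintype.card K : ℚ) ^ (m + 1)
          + ((Fintype.card K : ℚ) ^ m - 1) * Fintype.card K) else 0) +
      (if (Fintype.card K : ℤ) ^ (2 * m - 1) = w then ((Fintype.card K : ℚ) - 1) else 0) +
      ((Fintype.card K : ℚ) - 1) * S := by
  classical
  have hLc : (Fintype.card L : ℚ) = (Fintype.card K : ℚ) ^ m := by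
    rw [card_eq_pow hm]; push_cast; rfl
  have hw : ∀ τ, (hammingNorm (traceEval K (traceSet K L) τ) = w) =
      ((hammingNorm (traceEval K (traceSet K L) τ) : ℤ) = w) := fun τ => by rw [Nat.cast_inj]
  rw [tripleCount_eq_sum]
  push_cast at hS ⊢
  rw [sum_eq_of_cases (K := K) (A := if ((Fintype.card K : ℤ) - 1) *
    (Fintype.card K : ℤ) ^ (2 * m - 2) = w then (Fintype.card K : ℚ) ^ (m + 1) else 0) _ ?_ hS]
  · have h0 : ∑ c : L, (#{t : K | hammingNorm (traceEval K (traceSet K L) (t, 0, c)) = w} : ℚ) =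
        (if (0 : ℤ) = w then 1 else 0) +
        (if ((Fintype.card K : ℤ) - 1) * (Fintype.card K : ℤ) ^ (2 * m - 2) = w then
          ((Fintype.card K : ℚ) ^ m - 1) * Fintype.card K else 0) +
        (if (Fintype.card K : ℤ) ^ (2 * m - 1) = w then ((Fintype.card K : ℚ) - 1) else 0) := by
      have e1 : ∀ c ∈ univ.erase (0 : L),
          (#{t : K | hammingNorm (traceEval K (traceSet K L) (t, 0, c)) = w} : ℚ) =
          if ((Fintype.card K : ℤ) - 1) * (Fintype.card K : ℤ) ^ (2 * m - 2) = w then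
            (Fintype.card K : ℚ) else 0 := by
        intro c hc
        simp only [hw, weight_zero_left hm (by omega) _ (Finset.ne_of_mem_erase hc)]
        by_cases h : ((Fintype.card K : ℤ) - 1) * (Fintype.card K : ℤ) ^ (2 * m - 2) = w <;>
          simp [h]
      have e2 : (#{t : K | hammingNorm (traceEval K (traceSet K L) (t, 0, 0)) = w} : ℚ) =
          (if (0 : ℤ) = w then 1 else 0) +
          (if (Fintype.card K : ℤ) ^ (2 * m - 1) = w then ((Fintype.card K : ℚ) - 1) else 0) := by
        simp only [hw, weight_zero_zero (L := L) hm (by omega), Finset.card_filter]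
        rw [← Finset.add_sum_erase _ _ (mem_univ (0 : K)),
          Finset.sum_congr rfl fun t ht => by rw [if_neg (Finset.ne_of_mem_erase ht)]]
        simp only [if_true, Finset.sum_const, card_erase_of_mem (mem_univ _), card_univ]
        have h1 : ((Fintype.card K - 1 : ℕ) : ℚ) = (Fintype.card K : ℚ) - 1 := by
          rw [Nat.cast_sub Fintype.card_pos, Nat.cast_one]
        simp [h1]
      rw [← Finset.add_sum_erase _ _ (mem_univ (0 : L)), e2, Finset.sum_congr rfl e1,
        Finset.sum_const, card_erase_of_mem (mem_univ _), card_univ, nsmul_eq_mul,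
        Nat.cast_sub Fintype.card_pos, hLc]
      split_ifs <;> push_cast <;> ring
    rw [h0, hLc]
    have e3 : (if ((Fintype.card K : ℤ) - 1) * (Fintype.card K : ℤ) ^ (2 * m - 2) = w then
        (((Fintype.card K : ℚ) ^ m - Fintype.card K) * (Fintype.card K : ℚ) ^ (m + 1)
          + ((Fintype.card K : ℚ) ^ m - 1) * Fintype.card K) else 0) =
        ((Fintype.card K : ℚ) ^ m - Fintype.card K) *
          (if ((Fintype.card K : ℤ) - 1) * (Fintype.card K : ℤ) ^ (2 * m - 2) = w then
            (Fintype.card K : ℚ) ^ (m + 1) else 0) +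
        (if ((Fintype.card K : ℤ) - 1) * (Fintype.card K : ℤ) ^ (2 * m - 2) = w then
          ((Fintype.card K : ℚ) ^ m - 1) * Fintype.card K else 0) := by
      split_ifs <;> ring
    rw [e3]
    ring
  · intro b hb
    simp only [hw, weight_of_notMem hm hm2 _ _ hb]
    by_cases h : ((Fintype.card K : ℤ) - 1) * (Fintype.card K : ℤ) ^ (2 * m - 2) = w <;>
      simp [h, hLc, pow_succ]

end TraceCode

section TraceCodeParameters

variable {K L : Type*} [Field K] [Fintype K] [DecidableEq K] [Field L] [Fintype L] [Algebra K L]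

/-! ### The dual code -/

/-- A dual word supported on `{i, j}` is tested against a codeword that is nonzero at `i` and zero
at `j`; one supported on `{i}` alone, against a nowhere vanishing codeword. -/
theorem three_le_hammingNorm_of_mem_dualCode {F : Type*} [Field F] [DecidableEq F] {ι : Type*}
    [Fintype ι] {C : Submodule F (ι → F)} (h1 : ∃ c ∈ C, ∀ i, c i ≠ 0)
    (h2 : ∀ i j, i ≠ j → ∃ c ∈ C, c i ≠ 0 ∧ c j = 0) {x : ι → F} (hx : x ∈ dualCode C)
    (hx0 : x ≠ 0) : 3 ≤ hammingNorm x := by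
  classical
  by_contra! hlt
  obtain ⟨i, hi⟩ := Function.ne_iff.1 hx0
  have hmem : i ∈ Finset.univ.filter fun i => x i ≠ 0 := by simpa using hi
  have hcard : ((Finset.univ.filter fun i => x i ≠ 0).erase i).card ≤ 1 := by
    rw [Finset.card_erase_of_mem hmem]
    rw [hammingNorm] at hlt
    omega
  obtain ⟨j, hj⟩ : ∃ j, (Finset.univ.filter fun i => x i ≠ 0).erase i ⊆ {j} := by
    have : Nonempty ι := ⟨i⟩
    exact Finset.card_le_one_iff_subset_singleton.1 hcard
  obtain ⟨c, hc, hci, hcj⟩ : ∃ c ∈ C, c i ≠ 0 ∧ ∀ k, k ≠ i → x k * c k = 0 := by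
    by_cases hij : i = j
    · obtain ⟨c, hc, h⟩ := h1
      refine ⟨c, hc, h i, fun k hk => ?_⟩
      by_contra h0
      have := hj (Finset.mem_erase.2 ⟨hk, by simpa using left_ne_zero_of_mul h0⟩)
      rw [Finset.mem_singleton, ← hij] at this
      exact hk this
    · obtain ⟨c, hc, h, h'⟩ := h2 i j hij
      refine ⟨c, hc, h, fun k hk => ?_⟩
      by_contra h0
      have := hj (Finset.mem_erase.2 ⟨hk, by simpa using left_ne_zero_of_mul h0⟩)
      rw [Finset.mem_singleton] at this
      subst this
      exact h0 (by rw [h', mul_zero])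
  have h := hx c hc
  rw [dotProduct, Finset.sum_eq_single i (fun k _ hk => hcj k hk) (by simp)] at h
  exact mul_ne_zero hi hci h

theorem exists_trace_pair_ne_zero {P : L × L} (hP : P ≠ 0) :
    ∃ b c : L, Algebra.trace K L (b * P.1) + Algebra.trace K L (c * P.2) ≠ 0 := by
  by_contra! h
  apply hP
  ext
  · exact eq_zero_of_trace_mul_eq_zero (K := K) fun x => by simpa [mul_comm] using h x 0
  · exact eq_zero_of_trace_mul_eq_zero (K := K) fun x => by simpa [mul_comm] using h 0 x

theorem exists_traceEval_ne_zero (D : Finset (L × L)) :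
    ∃ c ∈ LinearMap.range (traceEval K D), ∀ P, c P ≠ 0 :=
  ⟨_, ⟨(1, 0, 0), rfl⟩, fun P => by simp [traceEval_apply]⟩

theorem exists_traceEval_separating (D : Finset (L × L)) (P P' : D) (h : P ≠ P') :
    ∃ c ∈ LinearMap.range (traceEval K D), c P ≠ 0 ∧ c P' = 0 := by
  obtain ⟨b, c, hbc⟩ := exists_trace_pair_ne_zero (K := K)
    (sub_ne_zero.2 fun h' => h (Subtype.ext h') : (P : L × L) - P' ≠ 0)
  -- The constant term is chosen to make the function vanish at `P'`.
  refine ⟨_, ⟨(-(Algebra.trace K L (b * P'.1.1) + Algebra.trace K L (c * P'.1.2)), b, c), rfl⟩,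
    ?_, ?_⟩
  · rw [traceEval_apply]
    intro h0
    apply hbc
    rw [Prod.fst_sub, Prod.snd_sub, mul_sub, mul_sub, map_sub, map_sub]
    linear_combination h0
  · rw [traceEval_apply]
    ring

theorem exists_ne_zero_trace_eq_zero (h : 2 ≤ Module.finrank K L) :
    ∃ x : L, x ≠ 0 ∧ Algebra.trace K L x = 0 := by
  have h1 := card_trace_eq_mul (L := L) (0 : K)
  have hq : 1 < Fintype.card K := Fintype.one_lt_card
  have h2 : Fintype.card K ^ 2 ≤ Fintype.card L := by
    rw [Module.card_eq_pow_finrank (K := K) (V := L)]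
    exact Nat.pow_le_pow_right hq.le h
  have h3 : 1 < (Finset.univ.filter fun x : L => Algebra.trace K L x = 0).card := by
    by_contra! h4
    nlinarith
  obtain ⟨x, hx, hx0⟩ := Finset.exists_mem_ne h3 0
  exact ⟨x, hx0, by simpa using hx⟩

/-- If `Tr x0 = 0`, the line `K • (x0, 0)` lies in `D`, and codewords restrict to affine functions
on it. Any three of its points are therefore dependent, and `q > 2` provides a third point. -/
theorem hasMinDist_dualCode_three (hm : 2 ≤ Module.finrank K L) (hq : 2 < Fintype.card K) :
    HasMinDist (dualCode (LinearMap.range (traceEval K (traceSet K L)))) 3 := by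
  classical
  have hlow : ∀ x ∈ dualCode (LinearMap.range (traceEval K (traceSet K L))), x ≠ 0 →
      3 ≤ hammingNorm x := fun x hx hx0 => three_le_hammingNorm_of_mem_dualCode
    (exists_traceEval_ne_zero _) (exists_traceEval_separating _) hx hx0
  rw [hasMinDist_iff]
  refine ⟨?_, hlow⟩
  obtain ⟨x0, hx0, htr⟩ := exists_ne_zero_trace_eq_zero hm
  obtain ⟨a, ha0, ha1⟩ : ∃ a : K, a ≠ 0 ∧ a ≠ 1 := by
    have : ∃ a, a ∉ ({0, 1} : Finset K) := by
      by_contra! h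
      have h2 := Finset.card_le_card (fun a _ => h a : Finset.univ ⊆ ({0, 1} : Finset K))
      rw [Finset.card_univ] at h2
      have := Finset.card_le_two (a := (0 : K)) (b := 1)
      omega
    obtain ⟨a, ha⟩ := this
    exact ⟨a, by simp_all, by simp_all⟩
  have hmem : ∀ u : K, (u • x0, (0 : L)) ∈ traceSet K L := by
    intro u
    rw [mem_traceSet]
    simp [htr]
  let P : K → traceSet K L := fun u => ⟨(u • x0, 0), hmem u⟩
  have hPinj : ∀ u v : K, P u = P v → u = v := by
    intro u v h
    have : u • x0 = v • x0 := congrArg (fun R : traceSet K L => R.1.1) h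
    exact smul_left_injective K hx0 this
  -- The coefficients express `(a - 1) h(0) - a h(1) + h(a) = 0` for affine `h`.
  let x : traceSet K L → K := Pi.single (P 0) (a - 1) + Pi.single (P 1) (-a) + Pi.single (P a) 1
  have hx : x ∈ dualCode (LinearMap.range (traceEval K (traceSet K L))) := by
    rintro _ ⟨⟨t, b, c⟩, rfl⟩
    simp only [x, add_dotProduct, single_dotProduct, traceEval_apply, P, zero_smul, one_smul,
      mul_zero, map_zero, mul_smul_comm, map_smul, smul_eq_mul]
    ring
  have hxa : x (P a) = 1 := by
    have h1 : P a ≠ P 0 := fun h => ha0 (hPinj _ _ h)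
    have h2 : P a ≠ P 1 := fun h => ha1 (hPinj _ _ h)
    simp [x, h1, h2]
  have hxne : x ≠ 0 := by
    intro h
    rw [h] at hxa
    simp at hxa
  refine ⟨x, hx, hxne, le_antisymm ?_ (hlow x hx hxne)⟩
  refine (Finset.card_le_card (t := {P 0, P 1, P a}) fun R hR => ?_).trans Finset.card_le_three
  by_contra hR'
  simp only [Finset.mem_insert, Finset.mem_singleton, not_or] at hR'
  refine (Finset.mem_filter.1 hR).2 ?_
  simp [x, hR'.1, hR'.2.1, hR'.2.2]

theorem card_coe_traceSet {m : ℕ} (hm : Module.finrank K L = m) (hm2 : 1 ≤ m) :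
    Fintype.card (traceSet K L) = Fintype.card K ^ (2 * m - 1) := by
  rw [Fintype.card_coe, card_traceSet hm hm2]

/-- Parameters of the code and its dual, given the weight distribution on triples. -/
theorem parameters_of_tripleCount {m : ℕ} (hm : Module.finrank K L = m) (hm2 : 2 ≤ m) {q : ℕ}
    (hKq : Fintype.card K = q) (hq : 2 < q) {table : List (ℤ × ℚ)}
    (h : ∀ w : ℕ, (tripleCount K L w : ℚ) =
      (((0, 1) :: table).map fun r => if r.1 = (w : ℤ) then r.2 else 0).sum)
    (hpos : ∀ r ∈ table, 0 < r.1) (hnd : (table.map Prod.fst).Nodup) (hne : ∀ r ∈ table, 0 < r.2)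
    {C : Submodule K (traceSet K L → K)} (hC : C = LinearMap.range (traceEval K (traceSet K L))) :
    IsLinearCode C (q ^ (2 * m - 1)) (2 * m + 1) ∧
    IsWeightCode C table.length ∧
    HasWeightDistribution C ((0, 1) :: table) ∧
    IsLinearCodeWithDist (dualCode C) (q ^ (2 * m - 1)) (q ^ (2 * m - 1) - 2 * m - 1) 3 ∧
    ∀ d : ℕ, (d : ℤ) ∈ table.map Prod.fst → (∀ r ∈ table, (d : ℤ) ≤ r.1) → HasMinDist C d := by
  subst hC
  subst hKq
  -- All other weights in the table are positive, so only the zero triple has weight `0`; this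
  -- yields injectivity and hence the dimension.
  have h0 : tripleCount K L 0 = 1 := by
    have := h 0
    rw [List.map_cons, List.sum_cons, List.sum_map_ite_eq_zero fun r hr => by
      simpa using (hpos r hr).ne'] at this
    simpa using this
  have hinj : Function.Injective (traceEval K (traceSet K L)) :=
    injective_of_card_hammingNorm_eq_zero _ h0
  have hn := card_coe_traceSet (L := L) hm (by omega)
  have hk := finrank_range_traceEval hm hinj
  have hdist : HasWeightDistribution (LinearMap.range (traceEval K (traceSet K L)))
      ((0, 1) :: table) := by
    intro w
    rw [← h w, tripleCount, card_hammingNorm_eq_mul]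
    rw [tripleCount] at h0
    rw [h0, mul_one]
  have hne' := fun r hr => (hne r hr).ne'
  refine ⟨⟨hn, hk⟩, hdist.isWeightCode hnd hne' hpos, hdist,
    ⟨⟨hn, ?_⟩, hasMinDist_dualCode_three (by omega) hq⟩,
    fun d hd hmin => hdist.hasMinDist hnd hne' hpos hd hmin⟩
  rw [finrank_dualCode, hn, hk]
  omega

/-! ### Odd characteristic -/

open Finset in
-- Completing the square with the shift `y = z + c / (2 β)`.
theorem card_trace_quadratic_eq (hK : ringChar K ≠ 2) {β : K} (hβ : β ≠ 0) (t : K) (c : L) :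
    #{y : L | t + Algebra.trace K L (c * y) = β * Algebra.trace K L (y ^ 2)} =
      traceSqCount K L (β⁻¹ * t + Algebra.trace K L (((2 * β)⁻¹ • c) ^ 2)) := by
  have h2 : (2 : K) ≠ 0 := Ring.two_ne_zero hK
  set e : L := (2 * β)⁻¹ • c with he
  have hc : c = (2 * β) • e := by rw [he, smul_inv_smul₀ (mul_ne_zero h2 hβ)]
  have key : ∀ z : L, t + Algebra.trace K L (c * (z + e)) = β * Algebra.trace K L ((z + e) ^ 2) ↔
      Algebra.trace K L (z ^ 2) = β⁻¹ * t + Algebra.trace K L (e ^ 2) := by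
    intro z
    have e1 : Algebra.trace K L (c * (z + e)) =
        2 * β * (Algebra.trace K L (e * z) + Algebra.trace K L (e ^ 2)) := by
      rw [hc, smul_mul_assoc, map_smul, smul_eq_mul, ← map_add]
      ring_nf
    have e2 : Algebra.trace K L ((z + e) ^ 2) = Algebra.trace K L (z ^ 2) +
        2 * Algebra.trace K L (e * z) + Algebra.trace K L (e ^ 2) := by
      rw [show (z + e) ^ 2 = z ^ 2 + (e * z + e * z) + e ^ 2 by ring]
      simp only [map_add]
      ring
    rw [e1, e2]
    constructor
    · intro h
      apply mul_left_cancel₀ hβ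
      rw [mul_add, mul_inv_cancel_left₀ hβ]
      linear_combination -h
    · intro h
      rw [h]
      field_simp
      ring
  rw [traceSqCount]
  refine Finset.card_bij' (fun y _ => y - e) (fun z _ => z + e) ?_ ?_ ?_ ?_
  · intro y hy
    simp only [mem_filter, mem_univ, true_and] at hy ⊢
    rw [← key, sub_add_cancel]
    exact hy
  · intro z hz
    simp only [mem_filter, mem_univ, true_and] at hz ⊢
    rwa [key]
  · intro y _; simp
  · intro y _; simp

open Finset in
-- For fixed `β` and `c`, the map `t ↦ β⁻¹ t + d` permutes `K`. So each `c` contributes the same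
-- number `A`, whatever `β` is.
theorem sum_card_weight_of_odd {m : ℕ} (hm : Module.finrank K L = m) (hm2 : 2 ≤ m)
    (hK : ringChar K ≠ 2) (w : ℕ) {A : ℚ} (hA : (#{s : K | (Fintype.card K : ℤ) ^ (m - 1) *
      ((Fintype.card K : ℤ) ^ m - traceSqCount K L s) = w} : ℚ) = A) {β : K} (hβ : β ≠ 0) :
    ((∑ c : L, #{t : K |
      hammingNorm (traceEval K (traceSet K L) (t, algebraMap K L β, c)) = w} : ℕ) : ℚ) =
    (Fintype.card K : ℚ) ^ m * A := by
  rw [← hA, ← Nat.cast_pow, ← Nat.cast_mul, Nat.cast_inj, ← card_eq_pow hm, ← card_univ,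
    ← smul_eq_mul, ← Finset.sum_const]
  refine Finset.sum_congr rfl fun c _ => ?_
  set d := Algebra.trace K L (((2 * β)⁻¹ • c) ^ 2)
  have hw : ∀ t : K, hammingNorm (traceEval K (traceSet K L) (t, algebraMap K L β, c)) = w ↔
      (Fintype.card K : ℤ) ^ (m - 1) *
      ((Fintype.card K : ℤ) ^ m - traceSqCount K L (β⁻¹ * t + d)) = w := by
    intro t
    rw [← Nat.cast_inj (R := ℤ), weight_algebraMap hm (by omega), card_trace_quadratic_eq hK hβ]
  refine Finset.card_bij' (fun t _ => β⁻¹ * t + d) (fun s _ => β * (s - d)) ?_ ?_ ?_ ?_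
  · intro t ht
    simp only [mem_filter, mem_univ, true_and] at ht ⊢
    rwa [← hw]
  · intro s hs
    simp only [mem_filter, mem_univ, true_and] at hs ⊢
    rwa [hw, inv_mul_cancel_left₀ hβ, sub_add_cancel]
  · intro t _
    simp [hβ]
  · intro s _
    simp [hβ]

theorem sum_quadraticChar_comp (hK : ringChar K ≠ 2) (φ : ℤ → ℚ) :
    ∑ s : K, φ (quadraticChar K s) =
      φ 0 + ((Fintype.card K : ℚ) - 1) / 2 * (φ 1 + φ (-1)) := by
  -- Even and odd parts of `φ` on `{-1, 1}`, with a correction at `0`; the odd part disappears in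
  -- the sum.
  have h : ∀ s : K, φ (quadraticChar K s) = (if s = 0 then φ 0 - (φ 1 + φ (-1)) / 2 else 0) +
      (φ 1 + φ (-1)) / 2 + ((quadraticChar K s : ℤ) : ℚ) * ((φ 1 - φ (-1)) / 2) := by
    intro s
    by_cases hs : s = 0
    · simp [hs]
    · rcases quadraticChar_dichotomy hs with h | h <;> rw [h, if_neg hs] <;> push_cast <;> ring
  simp_rw [h]
  rw [Finset.sum_add_distrib, Finset.sum_add_distrib, ← Finset.sum_mul, ← Int.cast_sum,
    quadraticChar_sum_zero hK]
  simp
  ring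

open Finset in
theorem card_traceSqCount_of_odd (hK : ringChar K ≠ 2) {k : ℕ}
    (hm : Module.finrank K L = 2 * k + 1) (w : ℕ) :
    (#{s : K | (Fintype.card K : ℤ) ^ (2 * k) *
      ((Fintype.card K : ℤ) ^ (2 * k + 1) - traceSqCount K L s) = w} : ℚ) =
    (if ((Fintype.card K : ℤ) - 1) * (Fintype.card K : ℤ) ^ (4 * k) = w then 1 else 0) +
    ((Fintype.card K : ℚ) - 1) / 2 *
    ((if ((Fintype.card K : ℤ) - 1) * (Fintype.card K : ℤ) ^ (4 * k) -
        (Fintype.card K : ℤ) ^ (3 * k) = w then 1 else 0) +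
     (if ((Fintype.card K : ℤ) - 1) * (Fintype.card K : ℤ) ^ (4 * k) +
        (Fintype.card K : ℤ) ^ (3 * k) = w then 1 else 0)) := by
  obtain ⟨δ, hδ, hZ⟩ := traceSqCount_of_odd hK hm
  have h := sum_quadraticChar_comp hK fun z => if ((Fintype.card K : ℤ) - 1) *
    (Fintype.card K : ℤ) ^ (4 * k) - z * ((Fintype.card K : ℤ) ^ (2 * k) * δ) = w then 1 else 0
  have e : ∀ s : K, (Fintype.card K : ℤ) ^ (2 * k) *
      ((Fintype.card K : ℤ) ^ (2 * k + 1) - traceSqCount K L s) = ((Fintype.card K : ℤ) - 1) *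
    (Fintype.card K : ℤ) ^ (4 * k) - quadraticChar K s * ((Fintype.card K : ℤ) ^ (2 * k) * δ) := by
    intro s
    rw [hZ]
    ring
  simp only [e]
  rw [Finset.card_filter]
  push_cast
  rw [h]
  have e3 : (Fintype.card K : ℤ) ^ (2 * k) * (Fintype.card K : ℤ) ^ k =
    (Fintype.card K : ℤ) ^ (3 * k) := by rw [← pow_add]; ring_nf
  -- The two signs of `δ` merely exchange the two outer weights.
  rcases hδ with h | h
  · rw [h, e3]
    simp only [zero_mul, sub_zero, one_mul, neg_mul, sub_neg_eq_add]
  · rw [h, mul_neg, e3]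
    simp only [zero_mul, sub_zero, one_mul, neg_mul, sub_neg_eq_add, mul_neg, neg_zero,
      ← sub_eq_add_neg]
    ring

theorem tripleCount_of_odd (hK : ringChar K ≠ 2) {k : ℕ} (hm : Module.finrank K L = 2 * k + 1)
    (hk : 1 ≤ k) (w : ℕ) :
    (tripleCount K L w : ℚ) = (([(0, 1),
      (((Fintype.card K : ℤ) - 1) * (Fintype.card K : ℤ) ^ (4 * k) - (Fintype.card K : ℤ) ^ (3 * k),
        (Fintype.card K : ℚ) ^ (2 * k + 1) * ((Fintype.card K : ℚ) - 1) ^ 2 / 2),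
      (((Fintype.card K : ℤ) - 1) * (Fintype.card K : ℤ) ^ (4 * k),
        (Fintype.card K : ℚ) ^ (2 * (2 * k + 1) + 1) - (Fintype.card K : ℚ) ^ (2 * k + 1 + 2)
          + 2 * (Fintype.card K : ℚ) ^ (2 * k + 1 + 1) - (Fintype.card K : ℚ) ^ (2 * k + 1)
          - (Fintype.card K : ℚ)),
      (((Fintype.card K : ℤ) - 1) * (Fintype.card K : ℤ) ^ (4 * k) + (Fintype.card K : ℤ) ^ (3 * k),
        (Fintype.card K : ℚ) ^ (2 * k + 1) * ((Fintype.card K : ℚ) - 1) ^ 2 / 2),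
      ((Fintype.card K : ℤ) ^ (4 * k + 1), (Fintype.card K : ℚ) - 1)] : List (ℤ × ℚ)).map
      fun r => if r.1 = (w : ℤ) then r.2 else 0).sum := by
  rw [tripleCount_eq hm (by omega) w fun β hβ =>
    sum_card_weight_of_odd hm (by omega) hK w (card_traceSqCount_of_odd hK hm w) hβ]
  rw [show 2 * (2 * k + 1) - 2 = 4 * k by omega, show 2 * (2 * k + 1) - 1 = 4 * k + 1 by omega]
  simp only [List.map_cons, List.map_nil, List.sum_cons, List.sum_nil]
  split_ifs <;> ring

open Finset in
-- The value `s = 0` gives one weight and the `q - 1` other values give another. The sign `ε` is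
-- opposite to that in `traceSqCount_of_even` because zeros are subtracted to obtain weights.
theorem card_traceSqCount_of_even (hK : ringChar K ≠ 2) {k : ℕ}
    (hm : Module.finrank K L = 2 * k) (hk : 1 ≤ k) (w : ℕ) {ε : ℤ}
    (hε : ε = if Fintype.card K ^ k % 4 = 3 then -1 else 1) :
    (#{s : K | (Fintype.card K : ℤ) ^ (2 * k - 1) *
      ((Fintype.card K : ℤ) ^ (2 * k) - traceSqCount K L s) = w} : ℚ) =
    (if ((Fintype.card K : ℤ) - 1) * (Fintype.card K : ℤ) ^ (4 * k - 2) +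
        ((Fintype.card K : ℤ) - 1) * (Fintype.card K : ℤ) ^ (3 * k - 2) * ε = w then 1 else 0) +
    ((Fintype.card K : ℚ) - 1) *
    (if ((Fintype.card K : ℤ) - 1) * (Fintype.card K : ℤ) ^ (4 * k - 2) -
        (Fintype.card K : ℤ) ^ (3 * k - 2) * ε = w then 1 else 0) := by
  obtain ⟨j, rfl⟩ : ∃ j, k = j + 1 := ⟨k - 1, by omega⟩
  have e : ∀ s : K, (Fintype.card K : ℤ) ^ (2 * (j + 1) - 1) *
      ((Fintype.card K : ℤ) ^ (2 * (j + 1)) - traceSqCount K L s) =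
      ((Fintype.card K : ℤ) - 1) * (Fintype.card K : ℤ) ^ (4 * (j + 1) - 2) +
        ((if s = 0 then (Fintype.card K : ℤ) else 0) - 1) *
          (Fintype.card K : ℤ) ^ (3 * (j + 1) - 2) * ε := by
    intro s
    rw [traceSqCount_of_even hK hm hk, hε, show 2 * (j + 1) - 1 = 2 * j + 1 by omega,
      show 4 * (j + 1) - 2 = 4 * j + 2 by omega, show 3 * (j + 1) - 2 = 3 * j + 1 by omega,
      show j + 1 - 1 = j by omega]
    split_ifs <;> ring
  simp only [e]
  rw [Finset.card_filter]
  push_cast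
  rw [← Finset.add_sum_erase _ _ (mem_univ (0 : K)),
    Finset.sum_congr rfl fun s hs => by rw [if_neg (Finset.ne_of_mem_erase hs)],
    Finset.sum_const, card_erase_of_mem (mem_univ _), card_univ, nsmul_eq_mul,
    Nat.cast_sub Fintype.card_pos, if_pos rfl, Nat.cast_one]
  congr 3
  rw [zero_sub, neg_one_mul, neg_mul, ← sub_eq_add_neg]

theorem tripleCount_of_even (hK : ringChar K ≠ 2) {k : ℕ} (hm : Module.finrank K L = 2 * k)
    (hk : 1 ≤ k) (w : ℕ) {ε : ℤ} (hε : ε = if Fintype.card K ^ k % 4 = 3 then -1 else 1) :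
    (tripleCount K L w : ℚ) = (([(0, 1),
      (((Fintype.card K : ℤ) - 1) * (Fintype.card K : ℤ) ^ (4 * k - 2)
          - (Fintype.card K : ℤ) ^ (3 * k - 2) * ε,
        (Fintype.card K : ℚ) ^ (2 * k + 2) - 2 * (Fintype.card K : ℚ) ^ (2 * k + 1)
          + (Fintype.card K : ℚ) ^ (2 * k)),
      (((Fintype.card K : ℤ) - 1) * (Fintype.card K : ℤ) ^ (4 * k - 2)
          + ((Fintype.card K : ℤ) - 1) * (Fintype.card K : ℤ) ^ (3 * k - 2) * ε,
        (Fintype.card K : ℚ) ^ (2 * k + 1) - (Fintype.card K : ℚ) ^ (2 * k)),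
      (((Fintype.card K : ℤ) - 1) * (Fintype.card K : ℤ) ^ (4 * k - 2),
        (Fintype.card K : ℚ) ^ (2 * (2 * k) + 1) - (Fintype.card K : ℚ) ^ (2 * k + 2)
          + (Fintype.card K : ℚ) ^ (2 * k + 1) - (Fintype.card K : ℚ)),
      ((Fintype.card K : ℤ) ^ (4 * k - 1), (Fintype.card K : ℚ) - 1)] : List (ℤ × ℚ)).map
      fun r => if r.1 = (w : ℤ) then r.2 else 0).sum := by
  rw [tripleCount_eq hm (by omega) w fun β hβ =>
    sum_card_weight_of_odd hm (by omega) hK w (card_traceSqCount_of_even hK hm hk w hε) hβ]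
  rw [show 2 * (2 * k) - 2 = 4 * k - 2 by omega, show 2 * (2 * k) - 1 = 4 * k - 1 by omega]
  simp only [List.map_cons, List.map_nil, List.sum_cons, List.sum_nil]
  split_ifs <;> ring

end TraceCodeParameters

/-! ### Weights in characteristic two -/

section CharacteristicTwo

variable {K L : Type*} [Field K] [Fintype K] [DecidableEq K] [Field L] [Fintype L] [Algebra K L]

/-- Squaring is additive, so it commutes with the sum of conjugates. -/
theorem trace_sq_of_charTwo [CharP K 2] (y : L) :
    Algebra.trace K L (y ^ 2) = Algebra.trace K L y ^ 2 := by
  have : CharP L 2 := charP_of_injective_algebraMap (algebraMap K L).injective 2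
  have : Fact (Nat.Prime 2) := ⟨Nat.prime_two⟩
  apply (algebraMap K L).injective
  rw [(algebraMap K L).map_pow, FiniteField.algebraMap_trace_eq_sum_pow,
    FiniteField.algebraMap_trace_eq_sum_pow, sum_pow_char]
  refine Finset.sum_congr rfl fun i _ => ?_
  rw [← pow_mul, ← pow_mul, mul_comm]

open Finset in
/-- For `b = β` in the subfield and `c` outside it, the codeword has the middle weight. -/
theorem weight_of_charTwo_of_notMem [CharP K 2] {m : ℕ} (hm : Module.finrank K L = m) (hm2 : 2 ≤ m)
    (t β : K) {c : L} (hc : c ∉ Set.range (algebraMap K L)) :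
    (hammingNorm (traceEval K (traceSet K L) (t, algebraMap K L β, c)) : ℤ)
      = ((Fintype.card K : ℤ) - 1) * (Fintype.card K : ℤ) ^ (2 * m - 2) := by
  obtain ⟨k, rfl⟩ : ∃ k, m = k + 2 := ⟨m - 2, by omega⟩
  have h : ∀ u v : K, #{x : L | Algebra.trace K L x = u ∧ Algebra.trace K L (c * x) = v} =
      Fintype.card K ^ k := by
    intro u v
    have := card_trace_prod_eq_mul hc u v
    rw [card_eq_pow hm, pow_add] at this
    exact Nat.eq_of_mul_eq_mul_right (pow_pos Fintype.card_pos 2) this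
  have h2 : #{y : L | t + Algebra.trace K L (c * y) = β * Algebra.trace K L (y ^ 2)} =
      Fintype.card K ^ (k + 1) := by
    rw [Finset.card_eq_sum_card_fiberwise (f := fun y => Algebra.trace K L y) (t := univ) (by simp)]
    rw [Finset.sum_congr rfl fun u _ => show _ = Fintype.card K ^ k from ?_, Finset.sum_const,
      card_univ, smul_eq_mul, pow_succ, mul_comm]
    rw [← h u (β * u ^ 2 - t)]
    congr 1
    ext y
    simp only [mem_filter, mem_univ, true_and, trace_sq_of_charTwo]
    constructor
    · rintro ⟨h1, rfl⟩
      exact ⟨rfl, by rw [← h1]; ring⟩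
    · rintro ⟨rfl, h1⟩
      exact ⟨by rw [h1]; ring, rfl⟩
  rw [weight_algebraMap hm (by omega), h2, show 2 * (k + 2) - 2 = 2 * k + 2 by omega,
    show k + 2 - 1 = k + 1 by omega]
  push_cast
  ring

open Finset in
-- Here the condition on `y` involves only `u = Tr y`, and each `u` has `q ^ (m - 1)` preimages.
theorem weight_of_charTwo [CharP K 2] {m : ℕ} (hm : Module.finrank K L = m) (hm2 : 1 ≤ m)
    (t β γ : K) :
    (hammingNorm (traceEval K (traceSet K L) (t, algebraMap K L β, algebraMap K L γ)) : ℤ)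
      = (Fintype.card K : ℤ) ^ (2 * m - 2) *
        ((Fintype.card K : ℤ) - #{u : K | β * u ^ 2 - γ * u = t}) := by
  obtain ⟨k, rfl⟩ : ∃ k, m = k + 1 := ⟨m - 1, by omega⟩
  have h : ∀ u : K, #{x : L | Algebra.trace K L x = u} = Fintype.card K ^ k := by
    intro u
    have := card_trace_eq_mul (L := L) u
    rw [card_eq_pow hm, pow_succ] at this
    exact Nat.eq_of_mul_eq_mul_right Fintype.card_pos this
  have h2 : #{y : L | t + Algebra.trace K L (algebraMap K L γ * y) =
      β * Algebra.trace K L (y ^ 2)} =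
      #{u : K | β * u ^ 2 - γ * u = t} * Fintype.card K ^ k := by
    rw [Finset.card_eq_sum_card_fiberwise (f := fun y => Algebra.trace K L y)
      (t := {u : K | β * u ^ 2 - γ * u = t}), ← smul_eq_mul, ← Finset.sum_const]
    · refine Finset.sum_congr rfl fun u hu => ?_
      rw [← h u]
      congr 1
      ext y
      simp only [mem_filter, mem_univ, true_and, trace_sq_of_charTwo, ← Algebra.smul_def, map_smul,
        smul_eq_mul] at hu ⊢
      refine ⟨fun h => h.2, fun h => ⟨?_, h⟩⟩
      rw [h, ← hu]; ring
    · intro y hy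
      simp only [coe_filter, mem_univ, true_and, Set.mem_ofPred_eq, trace_sq_of_charTwo,
        ← Algebra.smul_def, map_smul, smul_eq_mul] at hy ⊢
      rw [← hy]; ring
  rw [weight_algebraMap hm (by omega), h2, show 2 * (k + 1) - 2 = 2 * k by omega,
    show k + 1 - 1 = k by omega]
  push_cast
  ring

open Finset in
theorem card_roots_eq_one [CharP K 2] {β : K} (hβ : β ≠ 0) (t : K) :
    #{u : K | β * u ^ 2 - 0 * u = t} = 1 := by
  have : Fact (Nat.Prime 2) := ⟨Nat.prime_two⟩
  obtain ⟨v, hv⟩ := (bijective_frobenius K 2).surjective (β⁻¹ * t)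
  rw [frobenius_def] at hv
  rw [Finset.card_eq_one]
  refine ⟨v, ?_⟩
  ext u
  simp only [mem_filter, mem_univ, true_and, mem_singleton, zero_mul, sub_zero]
  constructor
  · intro hu
    apply (bijective_frobenius K 2).injective
    rw [frobenius_def, frobenius_def, hv, ← hu, inv_mul_cancel_left₀ hβ]
  · rintro rfl
    rw [hv, mul_inv_cancel_left₀ hβ]

open Finset in
-- Roots come in pairs `v`, `v + γ / β`, distinct because `γ ≠ 0`.
theorem card_roots_eq_zero_or_two [CharP K 2] {β γ : K} (hβ : β ≠ 0) (hγ : γ ≠ 0) (t : K) :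
    #{u : K | β * u ^ 2 - γ * u = t} = 0 ∨ #{u : K | β * u ^ 2 - γ * u = t} = 2 := by
  by_cases h : ∃ v : K, β * v ^ 2 - γ * v = t
  · right
    obtain ⟨v, hv⟩ := h
    have h2 : (2 : K) = 0 := CharTwo.two_eq_zero
    have hne : v ≠ v + γ / β := by
      intro h
      have : γ / β = 0 := by linear_combination -h
      exact div_ne_zero hγ hβ this
    have hroot : β * (γ / β) = γ := mul_div_cancel₀ γ hβ
    suffices hset : ({u : K | β * u ^ 2 - γ * u = t} : Finset K) = {v, v + γ / β} by
      rw [hset, Finset.card_pair hne]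
    ext u
    simp only [mem_filter, mem_univ, true_and, mem_insert, mem_singleton]
    constructor
    · intro hu
      have h3 : (u - v) * (u - (v + γ / β)) = 0 := by
        apply mul_left_cancel₀ hβ
        linear_combination hu - hv - (u - v) * hroot + β * v * (v - u) * h2
      rcases mul_eq_zero.1 h3 with h | h
      · exact Or.inl (sub_eq_zero.1 h)
      · exact Or.inr (sub_eq_zero.1 h)
    · rintro (rfl | rfl)
      · exact hv
      · linear_combination hv + (γ / β) * hroot + β * v * (γ / β) * h2
  · left
    rw [Finset.card_eq_zero, Finset.filter_eq_empty_iff]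
    intro u _ hu
    exact h ⟨u, hu⟩

open Finset in
theorem card_weight_of_charTwo [CharP K 2] {m : ℕ} (hm : Module.finrank K L = m) (hm2 : 1 ≤ m)
    (w : ℕ) {β γ : K} (hβ : β ≠ 0) (hγ : γ ≠ 0) :
    (#{t : K | hammingNorm (traceEval K (traceSet K L)
      (t, algebraMap K L β, algebraMap K L γ)) = w} : ℚ) =
    (Fintype.card K : ℚ) / 2 *
      ((if ((Fintype.card K : ℤ) - 2) * (Fintype.card K : ℤ) ^ (2 * m - 2) = w then 1 else 0) +
       (if (Fintype.card K : ℤ) ^ (2 * m - 1) = w then 1 else 0)) := by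
  have hsum : ∑ t : K, #{u : K | β * u ^ 2 - γ * u = t} = Fintype.card K :=
    (Finset.card_eq_sum_card_fiberwise (f := fun u : K => β * u ^ 2 - γ * u)
      (s := univ) (t := univ) (by simp)).symm
  set A : ℚ := if ((Fintype.card K : ℤ) - 2) * (Fintype.card K : ℤ) ^ (2 * m - 2) = w then 1 else 0
  set B : ℚ := if (Fintype.card K : ℤ) ^ (2 * m - 1) = w then 1 else 0
  -- As the number of roots is `0` or `2`, the indicator is an affine function of it. Summing over
  -- `t` then needs only that the total number of roots is `q`, so half of the `t` have two roots.
  have key : ∀ t : K, (if hammingNorm (traceEval K (traceSet K L)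
      (t, algebraMap K L β, algebraMap K L γ)) = w then (1 : ℚ) else 0) =
      B + (#{u : K | β * u ^ 2 - γ * u = t} : ℚ) * ((A - B) / 2) := by
    intro t
    have hw : hammingNorm (traceEval K (traceSet K L)
      (t, algebraMap K L β, algebraMap K L γ)) = w ↔ (Fintype.card K : ℤ) ^ (2 * m - 2) *
        ((Fintype.card K : ℤ) - #{u : K | β * u ^ 2 - γ * u = t}) = w := by
      rw [← weight_of_charTwo hm hm2, Nat.cast_inj]
    simp only [hw]
    rcases card_roots_eq_zero_or_two hβ hγ t with h | h
    · rw [h, Nat.cast_zero, sub_zero, ← pow_succ, show 2 * m - 2 + 1 = 2 * m - 1 by omega]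
      simp [B]
    · rw [h, mul_comm]
      simp only [A, Nat.cast_ofNat]
      ring
  rw [Finset.card_filter]
  push_cast
  rw [Finset.sum_congr rfl fun t _ => key t, Finset.sum_add_distrib, ← Finset.sum_mul,
    ← Nat.cast_sum, hsum, Finset.sum_const, card_univ, nsmul_eq_mul]
  ring

open Finset in
theorem tripleCount_of_charTwo [CharP K 2] {m : ℕ} (hm : Module.finrank K L = m) (hm2 : 2 ≤ m)
    (w : ℕ) :
    (tripleCount K L w : ℚ) = (([(0, 1),
         (((Fintype.card K : ℤ) - 2) * (Fintype.card K : ℤ) ^ (2 * m - 2),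
            (Fintype.card K : ℚ) * ((Fintype.card K : ℚ) - 1) ^ 2 / 2),
         (((Fintype.card K : ℤ) - 1) * (Fintype.card K : ℤ) ^ (2 * m - 2),
            (Fintype.card K : ℚ) ^ (2 * m + 1) - (Fintype.card K : ℚ) ^ 3
              + 2 * (Fintype.card K : ℚ) ^ 2 - 2 * (Fintype.card K : ℚ)),
         ((Fintype.card K : ℤ) ^ (2 * m - 1), ((Fintype.card K : ℚ) - 1) *
            ((Fintype.card K : ℚ) ^ 2 - (Fintype.card K : ℚ) + 2) / 2)] : List (ℤ × ℚ)).map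
      fun r => if r.1 = (w : ℤ) then r.2 else 0).sum := by
  set M : ℚ := if ((Fintype.card K : ℤ) - 1) * (Fintype.card K : ℤ) ^ (2 * m - 2) = w then
    (Fintype.card K : ℚ) else 0 with hM
  have hLc : (Fintype.card L : ℚ) = (Fintype.card K : ℚ) ^ m := by
    rw [card_eq_pow hm]; push_cast; rfl
  have hw : ∀ τ, (hammingNorm (traceEval K (traceSet K L) τ) = w) =
      ((hammingNorm (traceEval K (traceSet K L) τ) : ℤ) = w) := fun τ => by rw [Nat.cast_inj]
  have hmid : ∀ b c : L, (∀ t : K, (hammingNorm (traceEval K (traceSet K L) (t, b, c)) : ℤ) =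
      ((Fintype.card K : ℤ) - 1) * (Fintype.card K : ℤ) ^ (2 * m - 2)) →
      (#{t : K | hammingNorm (traceEval K (traceSet K L) (t, b, c)) = w} : ℚ) = M := by
    intro b c h
    simp only [hw, h, hM]
    by_cases h' : ((Fintype.card K : ℤ) - 1) * (Fintype.card K : ℤ) ^ (2 * m - 2) = w <;> simp [h']
  have h0 : ∀ β : K, β ≠ 0 → (#{t : K | hammingNorm (traceEval K (traceSet K L)
      (t, algebraMap K L β, 0)) = w} : ℚ) = M := by
    intro β hβ
    refine hmid _ _ fun t => ?_
    have := weight_of_charTwo hm (by omega) t β 0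
    rw [card_roots_eq_one hβ, map_zero] at this
    rw [this, mul_comm, Nat.cast_one]
  have hS := fun (β : K) (hβ : β ≠ 0) => sum_eq_of_cases (K := K) (fun c : L =>
      (#{t : K | hammingNorm (traceEval K (traceSet K L) (t, algebraMap K L β, c)) = w} : ℚ))
      (fun c hc => hmid _ c fun t => weight_of_charTwo_of_notMem hm hm2 t β hc)
      (fun γ hγ => card_weight_of_charTwo hm (by omega) w hβ hγ)
  rw [tripleCount_eq hm hm2 w fun β hβ => by rw [Nat.cast_sum, hS β hβ, h0 β hβ], hLc, hM]
  simp only [List.map_cons, List.map_nil, List.sum_cons, List.sum_nil]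
  split_ifs <;> ring

end CharacteristicTwo

/-! ### The binary case: bounds, optimality and the dual -/

section Binary

variable {K : Type*} [Field K] [Fintype K] [DecidableEq K]

theorem eq_one_of_card_eq_two (hK : Fintype.card K = 2) {a : K} (ha : a ≠ 0) : a = 1 := by
  have h := FiniteField.pow_card_sub_one_eq_one a ha
  rwa [hK, pow_one] at h

theorem charP_of_card_eq_two (hK : Fintype.card K = 2) : CharP K 2 :=
  charP_of_card_eq_prime hK

theorem finrank_eq_of_card_eq_two_pow (hK : Fintype.card K = 2) {V : Type*} [AddCommGroup V]
    [Module K V] [Fintype V] {a : ℕ} (hV : Fintype.card V = 2 ^ a) : Module.finrank K V = a := by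
  rw [Module.card_eq_pow_finrank (K := K), hK] at hV
  exact Nat.pow_right_injective le_rfl hV

variable {ι : Type*} [Fintype ι]

open Finset in
-- Translation by one codeword that is nonzero at `i` injects the codewords nonzero at `i` into
-- those vanishing there.
theorem card_ne_zero_mul_two_le (hK : Fintype.card K = 2) (C : Submodule K (ι → K)) [Fintype C]
    (i : ι) : #{c : C | c.1 i ≠ 0} * 2 ≤ Fintype.card C := by
  classical
  have h := Finset.card_filter_add_card_filter_not (s := (univ : Finset C)) fun c => c.1 i ≠ 0
  rw [card_univ] at h
  suffices #{c : C | c.1 i ≠ 0} ≤ #{c : C | ¬ c.1 i ≠ 0} by omega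
  by_cases hex : ∃ c0 : C, c0.1 i ≠ 0
  · obtain ⟨c0, hc0⟩ := hex
    refine Finset.card_le_card_of_injOn (fun c => c - c0) ?_ ?_
    · intro c hc
      simp only [coe_filter, mem_univ, true_and, Set.mem_ofPred_eq] at hc ⊢
      rw [not_not, Submodule.coe_sub, Pi.sub_apply, eq_one_of_card_eq_two hK hc,
        eq_one_of_card_eq_two hK hc0, sub_self]
    · intro c _ c' _ h
      exact sub_left_injective h
  · rw [Finset.filter_eq_empty_iff.2 fun c _ h => hex ⟨c, h⟩]
    simp

/-- The average weight bound for binary codes. -/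
theorem plotkin_bound (hK : Fintype.card K = 2) (C : Submodule K (ι → K)) {d : ℕ}
    (hd : HasMinDist C d) :
    (2 ^ Module.finrank K C - 1) * d * 2 ≤ Fintype.card ι * 2 ^ Module.finrank K C := by
  classical
  have : Fintype C := Fintype.ofFinite C
  have hC : Fintype.card C = 2 ^ Module.finrank K C := by
    rw [Module.card_eq_pow_finrank (K := K), hK]
  rw [← hC]
  have h1 : ∑ c : C, hammingNorm c.1 = ∑ i : ι, (Finset.univ.filter fun c : C => c.1 i ≠ 0).card := by
    simp only [hammingNorm, Finset.card_filter]
    exact Finset.sum_comm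
  have h2 : (∑ c : C, hammingNorm c.1) * 2 ≤ Fintype.card ι * Fintype.card C := by
    rw [h1, Finset.sum_mul]
    refine (Finset.sum_le_sum fun i _ => card_ne_zero_mul_two_le hK C i).trans ?_
    simp
  have h3 : (Fintype.card C - 1) * d ≤ ∑ c : C, hammingNorm c.1 := by
    rw [← Finset.add_sum_erase _ _ (Finset.mem_univ (0 : C))]
    refine le_trans ?_ (Nat.le_add_left _ _)
    rw [← Finset.card_univ, ← Finset.card_erase_of_mem (Finset.mem_univ (0 : C)), ← smul_eq_mul]
    refine Finset.card_nsmul_le_sum _ _ _ fun c hc => ?_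
    exact (hasMinDist_iff.1 hd).2 c.1 c.2 fun h => Finset.ne_of_mem_erase hc (Subtype.ext h)
  exact (Nat.mul_le_mul_right 2 h3).trans h2

/-- The sphere packing bound, restricted to the error vectors of weight `2`. -/
theorem card_mul_choose_two_le (hK : Fintype.card K = 2) (C : Submodule K (ι → K)) {d : ℕ}
    (hd : HasMinDist C d) (hd5 : 4 < d) :
    2 ^ Module.finrank K C * (Fintype.card ι).choose 2 ≤ 2 ^ Fintype.card ι := by
  classical
  have : Fintype C := Fintype.ofFinite C
  have hC : Fintype.card C = 2 ^ Module.finrank K C := by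
    rw [Module.card_eq_pow_finrank (K := K), hK]
  let v : Finset ι → ι → K := fun s i => if i ∈ s then 1 else 0
  have hv : ∀ s s', v s = v s' → s = s' := by
    intro s s' h
    ext i
    have := congrFun h i
    by_cases h1 : i ∈ s <;> by_cases h2 : i ∈ s' <;> simp [v, h1, h2] at this ⊢
  have hinj : Set.InjOn (fun z : C × Finset ι => z.1.1 + v z.2)
      ((Finset.univ ×ˢ Finset.univ.powersetCard 2 : Finset (C × Finset ι)) : Set (C × Finset ι)) := by
    rintro ⟨c, s⟩ hs ⟨c', s'⟩ hs' h
    simp only [Finset.coe_product, Set.mem_prod, Finset.mem_coe, Finset.mem_univ, true_and,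
      Finset.mem_powersetCard, Finset.subset_univ] at hs hs' h
    have hcc : c = c' := by
      by_contra hne
      have h1 := (hasMinDist_iff.1 hd).2 (c.1 - c'.1) (C.sub_mem c.2 c'.2)
        (sub_ne_zero.2 fun h => hne (Subtype.ext h))
      -- If two translates meet, the difference of their codewords lives on two pairs of
      -- coordinates, so its weight is at most `4 < d`.
      have h2 : hammingNorm (c.1 - c'.1) ≤ (s ∪ s').card := by
        refine Finset.card_le_card fun i hi => ?_
        by_contra hi'
        rw [Finset.mem_union, not_or] at hi'
        refine (Finset.mem_filter.1 hi).2 ?_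
        have := congrFun h i
        simpa [v, hi'.1, hi'.2, sub_eq_zero] using this
      have := Finset.card_union_le s s'
      omega
    subst hcc
    rw [hv s s' (add_left_cancel h)]
  have h := Finset.card_le_card_of_injOn _ (t := (Finset.univ : Finset (ι → K)))
    (fun _ _ => Finset.mem_coe.2 (Finset.mem_univ _)) hinj
  rw [Finset.card_product, Finset.card_univ, Finset.card_powersetCard, Finset.card_univ,
    Finset.card_univ, Fintype.card_fun, hK, hC] at h
  exact h

theorem two_mul_lt_choose_two {a : ℕ} (ha : 3 ≤ a) : 2 * 2 ^ a < (2 ^ a).choose 2 := by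
  obtain ⟨b, rfl⟩ : ∃ b, a = b + 1 := ⟨a - 1, by omega⟩
  have h8 : 2 ^ 3 ≤ 2 ^ (b + 1) := Nat.pow_le_pow_right (by norm_num) ha
  rw [Nat.choose_two_right, pow_succ] at *
  rw [mul_comm _ 2, mul_assoc, Nat.mul_div_cancel_left _ (by norm_num)]
  have : 7 ≤ 2 * 2 ^ b - 1 := by omega
  have hb : 0 < 2 ^ b := by positivity
  refine lt_of_lt_of_le ?_ (Nat.mul_le_mul_left (2 ^ b) this)
  omega

/-- The term `i = 2` alone breaks the bound: the redundancy leaves room for `2 * 2 ^ a` vectors per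
codeword, fewer than `(2 ^ a).choose 2` once `a ≥ 3`. -/
theorem not_satisfiesSpherePackingBound {a d : ℕ} (ha : 3 ≤ a) (hd : 4 < d) :
    ¬ SatisfiesSpherePackingBound 2 (2 ^ a) (2 ^ a - (a + 1)) d := by
  intro h
  rw [SatisfiesSpherePackingBound] at h
  have h1 : (2 ^ a).choose 2 ≤ ∑ i ∈ Finset.range ((d - 1) / 2 + 1),
      (2 ^ a).choose i * (2 - 1) ^ i := by
    have := Finset.single_le_sum (f := fun i => (2 ^ a).choose i * (2 - 1) ^ i)
      (fun i _ => Nat.zero_le _) (Finset.mem_range.2 (by omega : 2 < (d - 1) / 2 + 1))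
    simpa using this
  have h2 := two_mul_lt_choose_two ha
  have h3 : a + 1 ≤ 2 ^ a := Nat.lt_two_pow_self
  have h4 : 2 ^ (2 ^ a) = 2 ^ (2 ^ a - (a + 1)) * (2 * 2 ^ a) := by
    rw [mul_comm 2, ← pow_succ, ← pow_add, Nat.sub_add_cancel h3]
  rw [h4] at h
  have := Nat.le_of_mul_le_mul_left h (by positivity)
  omega

theorem meetsGriesmerBound_two (a : ℕ) : MeetsGriesmerBound 2 (2 ^ (a + 1)) (a + 2) (2 ^ a) := by
  rw [MeetsGriesmerBound, Finset.sum_range_succ]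
  have h1 : ∀ i ∈ Finset.range (a + 1), ⌈((2 ^ a : ℕ) : ℚ) / ((2 : ℕ) : ℚ) ^ i⌉ = 2 ^ (a - i) := by
    intro i hi
    rw [Finset.mem_range] at hi
    have : ((2 ^ a : ℕ) : ℚ) / ((2 : ℕ) : ℚ) ^ i = ((2 ^ (a - i) : ℤ) : ℚ) := by
      push_cast
      rw [div_eq_iff (by positivity), ← pow_add]
      congr 1
      omega
    rw [this, Int.ceil_intCast]
  -- The last term is `⌈1 / 2⌉`; it supplies the `1` missing from the geometric sum `2 ^ (a + 1) -
  -- 1`.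
  have h2 : ⌈((2 ^ a : ℕ) : ℚ) / ((2 : ℕ) : ℚ) ^ (a + 1)⌉ = 1 := by
    have : ((2 ^ a : ℕ) : ℚ) / ((2 : ℕ) : ℚ) ^ (a + 1) = 1 / 2 := by
      push_cast
      rw [pow_succ]
      field_simp
    rw [this]
    norm_num [Int.ceil_eq_iff]
  rw [Finset.sum_congr rfl h1, h2]
  have h3 := Finset.sum_range_reflect (fun i => (2 : ℤ) ^ i) (a + 1)
  simp only [Nat.add_sub_cancel] at h3
  rw [h3]
  have h4 := geom_sum_mul (2 : ℤ) (a + 1)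
  push_cast
  linarith

variable {L : Type*} [Field L] [Fintype L] [Algebra K L]

/-- For `q = 2` the weight `(q - 2) q ^ (2m - 2)` collapses to `0`, so two triples give the zero
word: the zero triple and `(0, 1, 1)`, by the equation of `D` itself. -/
theorem tripleCount_of_card_eq_two (hK : Fintype.card K = 2) {m : ℕ}
    (hm : Module.finrank K L = m) (hm2 : 2 ≤ m) (w : ℕ) : (tripleCount K L w : ℚ) =
      (if w = 0 then 2 else 0) + (if w = 2 ^ (2 * m - 2) then 2 * (2 ^ (2 * m) - 2) else 0) +
      (if w = 2 ^ (2 * m - 1) then 2 else 0) := by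
  have := charP_of_card_eq_two hK
  rw [tripleCount_of_charTwo hm hm2 w, hK]
  have e1 : ((2 : ℤ) ^ (2 * m - 2) = w) ↔ (w = 2 ^ (2 * m - 2)) := by
    rw [eq_comm]; exact_mod_cast Iff.rfl
  have e2 : ((2 : ℤ) ^ (2 * m - 1) = w) ↔ (w = 2 ^ (2 * m - 1)) := by
    rw [eq_comm]; exact_mod_cast Iff.rfl
  have e3 : ((0 : ℤ) = w) ↔ w = 0 := by
    rw [eq_comm]; exact_mod_cast Iff.rfl
  simp only [List.map_cons, List.map_nil, List.sum_cons, List.sum_nil, Nat.cast_ofNat, sub_self,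
    zero_mul, show ((2 : ℤ) - 1) = 1 by norm_num, one_mul, e1, e2, e3]
  split_ifs <;> ring

theorem weightCount_of_card_eq_two (hK : Fintype.card K = 2) {m : ℕ}
    (hm : Module.finrank K L = m) (hm2 : 2 ≤ m) (w : ℕ) :
    (weightCount (LinearMap.range (traceEval K (traceSet K L))) w : ℤ) =
      (if w = 0 then 1 else 0) + (if w = 2 ^ (2 * m - 2) then 2 ^ (2 * m) - 2 else 0) +
      (if w = 2 ^ (2 * m - 1) then 1 else 0) := by
  have h0 : tripleCount K L 0 = 2 := by
    have := tripleCount_of_card_eq_two (L := L) hK hm hm2 0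
    simp only [if_true, (pow_ne_zero _ two_ne_zero).symm, if_false, add_zero] at this
    exact_mod_cast this
  have h := card_hammingNorm_eq_mul (traceEval K (traceSet K L)) w
  have h1 := tripleCount_of_card_eq_two (L := L) hK hm hm2 w
  rw [tripleCount] at h0 h1
  rw [h, h0] at h1
  rw [← Int.cast_inj (α := ℚ)]
  push_cast at h1 ⊢
  have : (weightCount (LinearMap.range (traceEval K (traceSet K L))) w : ℚ) * 2 =
    ((if w = 0 then 1 else 0) + (if w = 2 ^ (2 * m - 2) then 2 ^ (2 * m) - 2 else 0) +
      (if w = 2 ^ (2 * m - 1) then 1 else 0)) * 2 := by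
    rw [h1]
    split_ifs <;> ring
  exact mul_right_cancel₀ two_ne_zero this

theorem finrank_range_traceEval_of_card_eq_two (hK : Fintype.card K = 2) {m : ℕ}
    (hm : Module.finrank K L = m) (hm2 : 2 ≤ m) :
    Module.finrank K (LinearMap.range (traceEval K (traceSet K L))) = 2 * m := by
  classical
  have h0 : tripleCount K L 0 = 2 := by
    have := tripleCount_of_card_eq_two (L := L) hK hm hm2 0
    simp only [if_true, (pow_ne_zero _ two_ne_zero).symm, if_false, add_zero] at this
    exact_mod_cast this
  have : Fintype (LinearMap.ker (traceEval K (traceSet K L))) := Fintype.ofFinite _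
  have hker : Fintype.card (LinearMap.ker (traceEval K (traceSet K L))) = 2 ^ 1 := by
    rw [pow_one, ← h0, tripleCount, Fintype.card_subtype]
    congr 1
    ext τ
    simp
  have h1 := finrank_eq_of_card_eq_two_pow hK hker
  have h2 := LinearMap.finrank_range_add_finrank_ker (traceEval K (traceSet K L))
  rw [h1, Module.finrank_prod, Module.finrank_prod, Module.finrank_self, hm] at h2
  omega

theorem weightEnumerator_of_card_eq_two (hK : Fintype.card K = 2) {m : ℕ}
    (hm : Module.finrank K L = m) (hm2 : 2 ≤ m) :
    weightEnumerator (LinearMap.range (traceEval K (traceSet K L))) =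
      1 + (2 ^ (2 * m) - 2) * X ^ (2 ^ (2 * m - 2)) + X ^ (2 ^ (2 * m - 1)) := by
  rw [weightEnumerator, card_coe_traceSet hm (by omega), hK]
  simp only [weightCount_of_card_eq_two hK hm hm2, map_add, add_mul, Finset.sum_add_distrib,
    apply_ite (Polynomial.C : ℤ → ℤ[X]), ite_mul, map_zero, zero_mul, Finset.sum_ite_eq']
  have h1 : 2 ^ (2 * m - 2) ≤ 2 ^ (2 * m - 1) := Nat.pow_le_pow_right (by norm_num) (by omega)
  rw [if_pos (by simp), if_pos (by simp; omega), if_pos (by simp)]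
  simp

theorem hasMinDist_of_card_eq_two (hK : Fintype.card K = 2) {m : ℕ}
    (hm : Module.finrank K L = m) (hm2 : 2 ≤ m) :
    HasMinDist (LinearMap.range (traceEval K (traceSet K L))) (2 ^ (2 * m - 2)) := by
  have h4 : (2 : ℤ) ^ 2 ≤ 2 ^ (2 * m) := pow_le_pow_right₀ (by norm_num) (by omega)
  have hlt : 2 ^ (2 * m - 2) < 2 ^ (2 * m - 1) := Nat.pow_lt_pow_right (by norm_num) (by omega)
  apply hasMinDist_of_weightCount
  · rw [← Nat.cast_ne_zero (R := ℤ), weightCount_of_card_eq_two hK hm hm2, if_neg (by positivity),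
      if_pos rfl, if_neg hlt.ne]
    omega
  · positivity
  · intro w hw hw0
    rw [← Nat.cast_ne_zero (R := ℤ), weightCount_of_card_eq_two hK hm hm2, if_neg hw0] at hw
    by_contra hlt'
    apply hw
    rw [if_neg (by omega), if_neg (by omega)]
    norm_num

theorem isOptimalCode_of_card_eq_two (hK : Fintype.card K = 2) {m : ℕ}
    (hm : Module.finrank K L = m) (hm2 : 2 ≤ m) :
    IsOptimalCode (LinearMap.range (traceEval K (traceSet K L)))
      (2 ^ (2 * m - 1)) (2 * m) (2 ^ (2 * m - 2)) := by
  refine ⟨⟨⟨by rw [card_coe_traceSet hm (by omega), hK],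
    finrank_range_traceEval_of_card_eq_two hK hm hm2⟩, hasMinDist_of_card_eq_two hK hm hm2⟩, ?_⟩
  rintro d hd ⟨C', ⟨-, hk⟩, hC'⟩
  -- With `A = 2 ^ (2m - 2)` the bound reads `2 (4 A - 1) d ≤ 8 A ^ 2`, which fails for `d ≥ A + 1`.
  have h := plotkin_bound hK C' hC'
  rw [hk, Fintype.card_fin] at h
  obtain ⟨k, rfl⟩ : ∃ k, m = k + 1 := ⟨m - 1, by omega⟩
  have e1 : 2 ^ (2 * (k + 1)) = 4 * 2 ^ (2 * (k + 1) - 2) := by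
    rw [show 2 * (k + 1) = 2 + (2 * (k + 1) - 2) by omega, pow_add]; simp
  have e2 : 2 ^ (2 * (k + 1) - 1) = 2 * 2 ^ (2 * (k + 1) - 2) := by
    rw [show 2 * (k + 1) - 1 = 1 + (2 * (k + 1) - 2) by omega, pow_add]; simp
  rw [e1, e2] at h
  have hA : 0 < 2 ^ (2 * (k + 1) - 2) := by positivity
  set A := 2 ^ (2 * (k + 1) - 2)
  zify [show 1 ≤ 4 * A by omega] at h hd hA
  nlinarith

theorem mul_self_of_card_eq_two (hK : Fintype.card K = 2) (a : K) : a ^ 2 = a := by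
  have := FiniteField.pow_card a
  rwa [hK] at this

theorem sum_eq_hammingNorm (hK : Fintype.card K = 2) (x : ι → K) :
    ∑ i, x i = (hammingNorm x : K) := by
  rw [hammingNorm, Finset.card_filter]
  push_cast
  refine Finset.sum_congr rfl fun i _ => ?_
  split_ifs with h
  · exact eq_one_of_card_eq_two hK h
  · exact not_not.1 h

/-- The all-one codeword forces even weight in the dual, so the lower bound `3` becomes `4`. It is
attained on the four points of the plane spanned by `(x0, 0)` and `(0, x0)` with `Tr x0 = 0`, over
which affine functions sum to zero. -/
theorem hasMinDist_dualCode_four (hK : Fintype.card K = 2) (hm : 2 ≤ Module.finrank K L) :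
    HasMinDist (dualCode (LinearMap.range (traceEval K (traceSet K L)))) 4 := by
  classical
  have := charP_of_card_eq_two hK
  have h2 : (2 : K) = 0 := CharTwo.two_eq_zero
  have hlow : ∀ x ∈ dualCode (LinearMap.range (traceEval K (traceSet K L))), x ≠ 0 →
      4 ≤ hammingNorm x := by
    intro x hx hx0
    have h3 := three_le_hammingNorm_of_mem_dualCode
      (exists_traceEval_ne_zero _) (exists_traceEval_separating _) hx hx0
    have h4 := hx _ ⟨(1, 0, 0), rfl⟩
    have h5 : traceEval K (traceSet K L) (1, 0, 0) = 1 := by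
      ext P; simp [traceEval_apply]
    rw [h5, dotProduct_one, sum_eq_hammingNorm hK, CharP.cast_eq_zero_iff K 2] at h4
    omega
  rw [hasMinDist_iff]
  refine ⟨?_, hlow⟩
  obtain ⟨x0, hx0, htr⟩ := exists_ne_zero_trace_eq_zero hm
  let P0 : traceSet K L := ⟨(0, 0), by rw [mem_traceSet]; simp⟩
  let P1 : traceSet K L := ⟨(x0, 0), by rw [mem_traceSet]; simp [htr]⟩
  let P2 : traceSet K L := ⟨(0, x0), by rw [mem_traceSet]; simp [trace_sq_of_charTwo, htr]⟩
  let P3 : traceSet K L := ⟨(x0, x0), by rw [mem_traceSet]; simp [trace_sq_of_charTwo, htr]⟩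
  let x : traceSet K L → K := Pi.single P0 1 + Pi.single P1 1 + Pi.single P2 1 + Pi.single P3 1
  have hx : x ∈ dualCode (LinearMap.range (traceEval K (traceSet K L))) := by
    rintro _ ⟨⟨t, b, c⟩, rfl⟩
    simp only [x, add_dotProduct, single_dotProduct, traceEval_apply, P0, P1, P2, P3,
      mul_zero, map_zero]
    linear_combination (2 * t + Algebra.trace K L (b * x0) + Algebra.trace K L (c * x0)) * h2
  have hxa : x P0 = 1 := by
    have h1 : P0 ≠ P1 := fun h => hx0 (congrArg (fun R : traceSet K L => R.1.1) h).symm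
    have h2 : P0 ≠ P2 := fun h => hx0 (congrArg (fun R : traceSet K L => R.1.2) h).symm
    have h3 : P0 ≠ P3 := fun h => hx0 (congrArg (fun R : traceSet K L => R.1.1) h).symm
    simp [x, h1, h2, h3]
  have hxne : x ≠ 0 := by
    intro h
    rw [h] at hxa
    simp at hxa
  refine ⟨x, hx, hxne, le_antisymm ?_ (hlow x hx hxne)⟩
  refine (Finset.card_le_card (t := {P0, P1, P2, P3}) fun R hR => ?_).trans Finset.card_le_four
  by_contra hR'
  simp only [Finset.mem_insert, Finset.mem_singleton, not_or] at hR'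
  refine (Finset.mem_filter.1 hR).2 ?_
  simp [x, hR'.1, hR'.2.1, hR'.2.2.1, hR'.2.2.2]

theorem isOptimalCode_dualCode_of_card_eq_two (hK : Fintype.card K = 2) {m : ℕ}
    (hm : Module.finrank K L = m) (hm2 : 2 ≤ m) :
    IsOptimalCode (dualCode (LinearMap.range (traceEval K (traceSet K L))))
      (2 ^ (2 * m - 1)) (2 ^ (2 * m - 1) - 2 * m) 4 := by
  have hn : Fintype.card (traceSet K L) = 2 ^ (2 * m - 1) := by
    rw [card_coe_traceSet hm (by omega), hK]
  refine ⟨⟨⟨hn, by rw [finrank_dualCode, hn, finrank_range_traceEval_of_card_eq_two hK hm hm2]⟩,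
    hasMinDist_dualCode_four hK (by omega)⟩, ?_⟩
  rintro d hd ⟨C', ⟨-, hk⟩, hC'⟩
  have h := card_mul_choose_two_le hK C' hC' hd
  rw [hk, Fintype.card_fin] at h
  have h2 := two_mul_lt_choose_two (a := 2 * m - 1) (by omega)
  have h3 : 2 * m - 1 < 2 ^ (2 * m - 1) := Nat.lt_two_pow_self
  have h4 : 2 ^ (2 ^ (2 * m - 1)) = 2 ^ (2 ^ (2 * m - 1) - 2 * m) * (2 * 2 ^ (2 * m - 1)) := by
    rw [mul_comm 2 (2 ^ (2 * m - 1)), ← pow_succ, ← pow_add]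
    congr 1
    omega
  rw [h4] at h
  have := Nat.le_of_mul_le_mul_left h (by positivity)
  omega

end Binary

/-! ### Identification with the first order Reed-Muller code -/

section ReedMuller

variable {K L : Type*} [Field K] [Fintype K] [DecidableEq K] [Field L] [Fintype L] [Algebra K L]

/-- Over the field of two elements `Tr (y ^ 2) = Tr y`, so `D` is the hyperplane `W` given by `Tr x
+ Tr y = 0`. A linear isomorphism of `W` with the coordinate space is the relabelling, and both
codes consist of the affine functions. -/
theorem permEquivalent_reedMuller (hK : Fintype.card K = 2) {m : ℕ}
    (hm : Module.finrank K L = m) (hm2 : 2 ≤ m) :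
    PermEquivalent (LinearMap.range (traceEval K (traceSet K L))) (reedMuller K 1 (2 * m - 1)) := by
  classical
  have := charP_of_card_eq_two hK
  let τ : L × L →ₗ[K] K := (Algebra.trace K L).coprod (Algebra.trace K L)
  let W : Submodule K (L × L) := LinearMap.ker τ
  have hmem : ∀ P : L × L, P ∈ traceSet K L ↔ P ∈ W := by
    intro P
    rw [mem_traceSet, trace_sq_of_charTwo, mul_self_of_card_eq_two hK]
    rfl
  let e0 : traceSet K L ≃ W := Equiv.subtypeEquivRight hmem
  have : Fintype W := Fintype.ofFinite W
  have hW : Fintype.card W = 2 ^ (2 * m - 1) := by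
    rw [← Fintype.card_congr e0, card_coe_traceSet hm (by omega), hK]
  have hfr : Module.finrank K W = Module.finrank K (Fin (2 * m - 1) → K) := by
    rw [finrank_eq_of_card_eq_two_pow hK hW, Module.finrank_fin_fun]
  let E : W ≃ₗ[K] (Fin (2 * m - 1) → K) := LinearEquiv.ofFinrankEq _ _ hfr
  refine ⟨e0.trans E.toEquiv, le_antisymm ?_ ?_⟩
  · rintro _ ⟨⟨t, b, c⟩, rfl⟩
    let φ : (Fin (2 * m - 1) → K) →ₗ[K] K :=
      (((Algebra.trace K L).comp (LinearMap.mulLeft K b)).coprod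
        ((Algebra.trace K L).comp (LinearMap.mulLeft K c))).comp (W.subtype.comp E.symm.toLinearMap)
    let p : MvPolynomial (Fin (2 * m - 1)) K := MvPolynomial.C t +
      ∑ i, MvPolynomial.C (φ (Pi.single i 1)) * MvPolynomial.X i
    have hp : p ∈ MvPolynomial.restrictTotalDegree (Fin (2 * m - 1)) K 1 := by
      refine Submodule.add_mem _ ?_ (Submodule.sum_mem _ fun i _ => ?_)
      · rw [MvPolynomial.mem_restrictTotalDegree, MvPolynomial.totalDegree_C]
        exact Nat.zero_le _
      · rw [MvPolynomial.mem_restrictTotalDegree]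
        refine (MvPolynomial.totalDegree_mul _ _).trans ?_
        rw [MvPolynomial.totalDegree_C, MvPolynomial.totalDegree_X]
    refine ⟨MvPolynomial.evalₗ K _ p, ⟨p, hp, rfl⟩, ?_⟩
    ext P
    have h1 : φ (E (e0 P)) = ∑ i, φ (Pi.single i 1) * E (e0 P) i := by
      conv_lhs => rw [LinearMap.pi_apply_eq_sum_univ φ (E (e0 P))]
      refine Finset.sum_congr rfl fun i _ => ?_
      rw [smul_eq_mul, mul_comm]
      congr 2
      ext j
      rw [Pi.single_apply]
      simp [eq_comm]
    have h2 : φ (E (e0 P)) = Algebra.trace K L (b * P.1.1) + Algebra.trace K L (c * P.1.2) := by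
      simp [φ, e0]
    rw [traceEval_apply, add_assoc, ← h2, h1]
    simp [LinearMap.funLeft_apply, p]
  · rw [reedMuller, MvPolynomial.restrictTotalDegree, MvPolynomial.restrictSupport_eq_span,
      Submodule.map_span, Submodule.map_span, Submodule.span_le]
    rintro _ ⟨_, ⟨_, ⟨s, hs, rfl⟩, rfl⟩, rfl⟩
    have hs' : s.sum (fun _ e => e) ≤ 1 := hs
    rcases Nat.le_one_iff_eq_zero_or_eq_one.1 hs' with h | h
    · have hs0 : s = 0 := by
        ext i
        by_contra hi
        exact hi (Finset.sum_eq_zero_iff.1 h i (Finsupp.mem_support_iff.2 hi))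
      subst hs0
      refine ⟨(1, 0, 0), ?_⟩
      ext P
      simp [traceEval_apply, LinearMap.funLeft_apply]
    · obtain ⟨i, rfl⟩ := (Finsupp.sum_eq_one_iff s).1 h
      -- A coordinate function lives only on `W`; it is extended to `L × L` so that the trace form
      -- can represent it by a pair `(b, c)`.
      obtain ⟨g, hg⟩ := LinearMap.exists_extend ((LinearMap.proj i).comp E.toLinearMap)
      obtain ⟨b, hb⟩ := exists_trace_mul_eq (g.comp (LinearMap.inl K L L))
      obtain ⟨c, hc⟩ := exists_trace_mul_eq (g.comp (LinearMap.inr K L L))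
      refine ⟨(0, b, c), ?_⟩
      ext P
      have h1 : E (e0 P) i = g P.1 := by
        have := congrArg (fun f => f (e0 P)) hg
        exact this.symm
      have h2 : g P.1 = Algebra.trace K L (b * P.1.1) + Algebra.trace K L (c * P.1.2) := by
        rw [← hb, ← hc, LinearMap.comp_apply, LinearMap.comp_apply, ← map_add]
        simp
      rw [traceEval_apply, zero_add, ← h2, ← h1]
      simp [LinearMap.funLeft_apply, MvPolynomial.eval_monomial]

end ReedMuller

/-! ### Code parameters from the weight tables -/

section Parameters

variable {K L : Type*} [Field K] [Fintype K] [DecidableEq K] [Field L] [Fintype L] [Algebra K L]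

theorem parameters_of_charTwo [CharP K 2] {m : ℕ} (hm : Module.finrank K L = m) (hm2 : 2 ≤ m)
    {q : ℕ} (hq : Fintype.card K = q) (hq4 : 4 ≤ q)
    {C : Submodule K (traceSet K L → K)} (hC : C = LinearMap.range (traceEval K (traceSet K L))) :
    IsLinearCodeWithDist C (q ^ (2 * m - 1)) (2 * m + 1) ((q - 2) * q ^ (2 * m - 2)) ∧
      IsWeightCode C 3 ∧
      HasWeightDistribution C
        [(0, 1),
         (((q : ℤ) - 2) * (q : ℤ) ^ (2 * m - 2), (q : ℚ) * ((q : ℚ) - 1) ^ 2 / 2),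
         (((q : ℤ) - 1) * (q : ℤ) ^ (2 * m - 2),
            (q : ℚ) ^ (2 * m + 1) - (q : ℚ) ^ 3 + 2 * (q : ℚ) ^ 2 - 2 * (q : ℚ)),
         ((q : ℤ) ^ (2 * m - 1), ((q : ℚ) - 1) * ((q : ℚ) ^ 2 - (q : ℚ) + 2) / 2)] ∧
      IsLinearCodeWithDist (dualCode C) (q ^ (2 * m - 1)) (q ^ (2 * m - 1) - 2 * m - 1) 3 := by
  have htab := tripleCount_of_charTwo (L := L) hm hm2
  rw [hq] at htab
  have hqZ : (4 : ℤ) ≤ q := by exact_mod_cast hq4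
  have hqQ : (4 : ℚ) ≤ q := by exact_mod_cast hq4
  -- In terms of the opaque `A` and `B` the weights are `B`, `B + A`, `B + 2 A`, so distinctness and
  -- minimality become linear arithmetic.
  obtain ⟨A, hA⟩ : ∃ A : ℤ, A = (q : ℤ) ^ (2 * m - 2) := ⟨_, rfl⟩
  obtain ⟨B, hB⟩ : ∃ B : ℤ, B = ((q : ℤ) - 2) * A := ⟨_, rfl⟩
  have hApos : 0 < A := by rw [hA]; positivity
  have hBpos : 0 < B := by rw [hB]; exact mul_pos (by omega) hApos
  have hfull : (q : ℤ) ^ (2 * m - 1) = B + 2 * A := by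
    rw [hB, hA, show 2 * m - 1 = (2 * m - 2) + 1 by omega, pow_succ]; ring
  have hmid : ((q : ℤ) - 1) * A = B + A := by rw [hB]; ring
  have hd : (((q - 2) * q ^ (2 * m - 2) : ℕ) : ℤ) = B := by
    push_cast [show 2 ≤ q by omega]
    rw [hB, hA]
  have hm1 : (0 : ℚ) < (q : ℚ) * ((q : ℚ) - 1) ^ 2 / 2 := by
    have : 0 < (q : ℚ) - 1 := by linarith
    positivity
  have hm2 : (0 : ℚ) < (q : ℚ) ^ (2 * m + 1) - (q : ℚ) ^ 3 + 2 * (q : ℚ) ^ 2 - 2 * (q : ℚ) := by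
    have h3 : (q : ℚ) ^ 3 ≤ (q : ℚ) ^ (2 * m + 1) := pow_le_pow_right₀ (by linarith) (by omega)
    nlinarith
  have hm3 : (0 : ℚ) < ((q : ℚ) - 1) * ((q : ℚ) ^ 2 - (q : ℚ) + 2) / 2 := by
    have : 0 < ((q : ℚ) - 1) * ((q : ℚ) ^ 2 - (q : ℚ) + 2) := mul_pos (by linarith) (by nlinarith)
    linarith
  simp only [hfull, ← hA, ← hB, hmid] at htab ⊢
  obtain ⟨h1, h2, h3, h4, h5⟩ := parameters_of_tripleCount hm (by omega) hq (by omega) htab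
    (by simp only [List.forall_mem_cons, List.not_mem_nil, false_imp_iff, implies_true, and_true]
        omega)
    (by simp only [List.map_cons, List.map_nil, List.nodup_cons, List.mem_cons, List.not_mem_nil,
          or_false, List.nodup_nil, not_false_eq_true, and_true]
        omega)
    (by simp only [List.forall_mem_cons, List.not_mem_nil, false_imp_iff, implies_true, and_true]
        exact ⟨hm1, hm2, hm3⟩) hC
  refine ⟨⟨h1, h5 _ ?_ ?_⟩, h2, h3, h4⟩
  · rw [hd]
    simp
  · rw [hd]
    simp only [List.forall_mem_cons, List.not_mem_nil, false_imp_iff, implies_true, and_true]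
    omega

theorem parameters_of_odd_of_odd (hK : ringChar K ≠ 2) {k : ℕ}
    (hm : Module.finrank K L = 2 * k + 1) (hk : 1 ≤ k) {q : ℕ} (hq : Fintype.card K = q)
    (hq3 : 3 ≤ q)
    {C : Submodule K (traceSet K L → K)} (hC : C = LinearMap.range (traceEval K (traceSet K L))) :
    IsLinearCodeWithDist C (q ^ (4 * k + 1)) (2 * (2 * k + 1) + 1)
        ((q - 1) * q ^ (4 * k) - q ^ (3 * k)) ∧
      IsWeightCode C 4 ∧
      HasWeightDistribution C
        [(0, 1),
         (((q : ℤ) - 1) * (q : ℤ) ^ (4 * k) - (q : ℤ) ^ (3 * k),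
            (q : ℚ) ^ (2 * k + 1) * ((q : ℚ) - 1) ^ 2 / 2),
         (((q : ℤ) - 1) * (q : ℤ) ^ (4 * k),
            (q : ℚ) ^ (2 * (2 * k + 1) + 1) - (q : ℚ) ^ (2 * k + 1 + 2)
              + 2 * (q : ℚ) ^ (2 * k + 1 + 1) - (q : ℚ) ^ (2 * k + 1) - (q : ℚ)),
         (((q : ℤ) - 1) * (q : ℤ) ^ (4 * k) + (q : ℤ) ^ (3 * k),
            (q : ℚ) ^ (2 * k + 1) * ((q : ℚ) - 1) ^ 2 / 2),
         ((q : ℤ) ^ (4 * k + 1), (q : ℚ) - 1)] ∧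
      IsLinearCodeWithDist (dualCode C) (q ^ (4 * k + 1))
        (q ^ (4 * k + 1) - 2 * (2 * k + 1) - 1) 3 := by
  have htab := tripleCount_of_odd (L := L) hK hm hk
  rw [hq] at htab
  have hqZ : (3 : ℤ) ≤ q := by exact_mod_cast hq3
  have hqQ : (3 : ℚ) ≤ q := by exact_mod_cast hq3
  -- The weights become `B - E`, `B`, `B + E`, `B + A` with `0 < E < A ≤ B`.
  obtain ⟨A, hA⟩ : ∃ A : ℤ, A = (q : ℤ) ^ (4 * k) := ⟨_, rfl⟩
  obtain ⟨E, hE⟩ : ∃ E : ℤ, E = (q : ℤ) ^ (3 * k) := ⟨_, rfl⟩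
  obtain ⟨B, hB⟩ : ∃ B : ℤ, B = ((q : ℤ) - 1) * A := ⟨_, rfl⟩
  have hEpos : 0 < E := by rw [hE]; positivity
  have hEA : E < A := by rw [hE, hA]; exact pow_lt_pow_right₀ (by omega) (by omega)
  have hAB : A ≤ B := by rw [hB]; nlinarith
  have hfull : (q : ℤ) ^ (4 * k + 1) = B + A := by
    rw [hB, hA, pow_succ]; ring
  have hd : (((q - 1) * q ^ (4 * k) - q ^ (3 * k) : ℕ) : ℤ) = B - E := by
    rw [Nat.cast_sub]
    · push_cast [show 1 ≤ q by omega]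
      rw [hB, hA, hE]
    · zify [show 1 ≤ q by omega]
      rw [← hA, ← hE, ← hB]
      omega
  have hm1 : (0 : ℚ) < (q : ℚ) ^ (2 * k + 1) * ((q : ℚ) - 1) ^ 2 / 2 := by
    have : 0 < (q : ℚ) - 1 := by linarith
    positivity
  have hm2 : (0 : ℚ) < (q : ℚ) ^ (2 * (2 * k + 1) + 1) - (q : ℚ) ^ (2 * k + 1 + 2)
              + 2 * (q : ℚ) ^ (2 * k + 1 + 1) - (q : ℚ) ^ (2 * k + 1) - (q : ℚ) := by
    have hM : (q : ℚ) ≤ (q : ℚ) ^ (2 * k + 1) := le_self_pow₀ (by linarith) (by omega)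
    have e : (q : ℚ) ^ (2 * (2 * k + 1) + 1) - (q : ℚ) ^ (2 * k + 1 + 2)
              + 2 * (q : ℚ) ^ (2 * k + 1 + 1) - (q : ℚ) ^ (2 * k + 1) - (q : ℚ) =
        (q : ℚ) ^ (2 * k + 1) * (q * ((q : ℚ) ^ (2 * k + 1) - q)) +
        ((q : ℚ) ^ (2 * k + 1) - q) * (2 * q - 1) + 2 * q * (q - 1) := by ring
    rw [e]
    have h1 : 0 ≤ (q : ℚ) ^ (2 * k + 1) - q := by linarith
    have h2 : 0 < 2 * (q : ℚ) - 1 := by linarith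
    have h3 : 0 < (q : ℚ) - 1 := by linarith
    positivity
  have hm3 : (0 : ℚ) < (q : ℚ) - 1 := by linarith
  simp only [hfull, ← hA, ← hE, ← hB] at htab ⊢
  obtain ⟨h1, h2, h3, h4, h5⟩ := parameters_of_tripleCount hm (by omega) hq (by omega) htab
    (by simp only [List.forall_mem_cons, List.not_mem_nil, false_imp_iff, implies_true, and_true]
        omega)
    (by simp only [List.map_cons, List.map_nil, List.nodup_cons, List.mem_cons, List.not_mem_nil,
          or_false, List.nodup_nil, not_false_eq_true, and_true]
        omega)
    (by simp only [List.forall_mem_cons, List.not_mem_nil, false_imp_iff, implies_true, and_true]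
        exact ⟨hm1, hm2, hm1, hm3⟩) hC
  rw [show 2 * (2 * k + 1) - 1 = 4 * k + 1 by omega] at h1 h4
  refine ⟨⟨h1, h5 _ ?_ ?_⟩, h2, h3, h4⟩
  · rw [hd]
    simp
  · rw [hd]
    simp only [List.forall_mem_cons, List.not_mem_nil, false_imp_iff, implies_true, and_true]
    omega

theorem parameters_of_odd_of_even (hK : ringChar K ≠ 2) {k : ℕ}
    (hm : Module.finrank K L = 2 * k) (hk : 1 ≤ k) {q : ℕ} (hq : Fintype.card K = q)
    (hq3 : 3 ≤ q) {ε : ℤ} (hε : ε = if q ^ k % 4 = 3 then -1 else 1)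
    {C : Submodule K (traceSet K L → K)} (hC : C = LinearMap.range (traceEval K (traceSet K L))) :
    IsLinearCode C (q ^ (4 * k - 1)) (2 * (2 * k) + 1) ∧
      IsWeightCode C 4 ∧
      HasWeightDistribution C
        [(0, 1),
         (((q : ℤ) - 1) * (q : ℤ) ^ (4 * k - 2) - (q : ℤ) ^ (3 * k - 2) * ε,
            (q : ℚ) ^ (2 * k + 2) - 2 * (q : ℚ) ^ (2 * k + 1) + (q : ℚ) ^ (2 * k)),
         (((q : ℤ) - 1) * (q : ℤ) ^ (4 * k - 2) + ((q : ℤ) - 1) * (q : ℤ) ^ (3 * k - 2) * ε,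
            (q : ℚ) ^ (2 * k + 1) - (q : ℚ) ^ (2 * k)),
         (((q : ℤ) - 1) * (q : ℤ) ^ (4 * k - 2),
            (q : ℚ) ^ (2 * (2 * k) + 1) - (q : ℚ) ^ (2 * k + 2) + (q : ℚ) ^ (2 * k + 1)
              - (q : ℚ)),
         ((q : ℤ) ^ (4 * k - 1), (q : ℚ) - 1)] ∧
      IsLinearCodeWithDist (dualCode C) (q ^ (4 * k - 1))
        (q ^ (4 * k - 1) - 2 * (2 * k) - 1) 3 := by
  have htab := fun w => tripleCount_of_even (L := L) hK hm hk w (hq.symm ▸ hε)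
  rw [hq] at htab
  have hqZ : (3 : ℤ) ≤ q := by exact_mod_cast hq3
  have hqQ : (3 : ℚ) ≤ q := by exact_mod_cast hq3
  obtain ⟨A, hA⟩ : ∃ A : ℤ, A = (q : ℤ) ^ (4 * k - 2) := ⟨_, rfl⟩
  obtain ⟨E, hE⟩ : ∃ E : ℤ, E = (q : ℤ) ^ (3 * k - 2) := ⟨_, rfl⟩
  obtain ⟨B, hB⟩ : ∃ B : ℤ, B = ((q : ℤ) - 1) * A := ⟨_, rfl⟩
  obtain ⟨F, hF⟩ : ∃ F : ℤ, F = ((q : ℤ) - 1) * E := ⟨_, rfl⟩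
  have hEpos : 0 < E := by rw [hE]; positivity
  have hEF : 2 * E ≤ F := by rw [hF]; nlinarith
  have hFA : F < A := by
    have h1 : E * q ≤ A := by
      rw [hE, hA, ← pow_succ]
      exact pow_le_pow_right₀ (by omega) (by omega)
    rw [hF]
    nlinarith
  have hAB : A ≤ B := by rw [hB]; nlinarith
  have hfull : (q : ℤ) ^ (4 * k - 1) = B + A := by
    rw [hB, hA, show 4 * k - 1 = (4 * k - 2) + 1 by omega, pow_succ]; ring
  have hM : (q : ℚ) ≤ (q : ℚ) ^ (2 * k) := le_self_pow₀ (by linarith) (by omega)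
  have hm3 : (0 : ℚ) < (q : ℚ) - 1 := by linarith
  have hm0 : (0 : ℚ) < (q : ℚ) ^ (2 * k + 2) - 2 * (q : ℚ) ^ (2 * k + 1) + (q : ℚ) ^ (2 * k) := by
    rw [show (q : ℚ) ^ (2 * k + 2) - 2 * (q : ℚ) ^ (2 * k + 1) + (q : ℚ) ^ (2 * k) =
      (q : ℚ) ^ (2 * k) * (q - 1) ^ 2 by ring]
    positivity
  have hm1 : (0 : ℚ) < (q : ℚ) ^ (2 * k + 1) - (q : ℚ) ^ (2 * k) := by
    rw [show (q : ℚ) ^ (2 * k + 1) - (q : ℚ) ^ (2 * k) = (q : ℚ) ^ (2 * k) * (q - 1) by ring]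
    positivity
  have hm2 : (0 : ℚ) < (q : ℚ) ^ (2 * (2 * k) + 1) - (q : ℚ) ^ (2 * k + 2)
      + (q : ℚ) ^ (2 * k + 1) - (q : ℚ) := by
    rw [show (q : ℚ) ^ (2 * (2 * k) + 1) - (q : ℚ) ^ (2 * k + 2)
      + (q : ℚ) ^ (2 * k + 1) - (q : ℚ) = (q : ℚ) ^ (2 * k) * (q * ((q : ℚ) ^ (2 * k) - q)) +
        q * ((q : ℚ) ^ (2 * k) - q) + q * (q - 1) by ring]
    have h1 : 0 ≤ (q : ℚ) ^ (2 * k) - q := by linarith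
    positivity
  have hε' : ε = 1 ∨ ε = -1 := by
    rw [hε]; split_ifs <;> simp
  -- The weights are `B ∓ E`, `B ± F`, `B` and `B + A`, with `0 < E < F < A ≤ B`; for either sign
  -- they are distinct and positive.
  have hEFε : (E * ε = E ∧ F * ε = F) ∨ (E * ε = -E ∧ F * ε = -F) := by
    rcases hε' with h | h <;> simp [h]
  simp only [hfull, ← hA, ← hE, ← hB, ← hF] at htab ⊢
  generalize E * ε = E' at *
  generalize F * ε = F' at *
  obtain ⟨h1, h2, h3, h4, h5⟩ := parameters_of_tripleCount hm (by omega) hq (by omega) htab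
    (by simp only [List.forall_mem_cons, List.not_mem_nil, false_imp_iff, implies_true, and_true]
        omega)
    (by simp only [List.map_cons, List.map_nil, List.nodup_cons, List.mem_cons, List.not_mem_nil,
          or_false, List.nodup_nil, not_false_eq_true, and_true]
        omega)
    (by simp only [List.forall_mem_cons, List.not_mem_nil, false_imp_iff, implies_true, and_true]
        exact ⟨hm0, hm1, hm2, hm3⟩) hC
  rw [show 2 * (2 * k) - 1 = 4 * k - 1 by omega] at h1 h4
  exact ⟨h1, h2, h3, h4⟩

/-- For `p = 2 h + 1` the exponent is `l k h`, which is odd exactly when `p ≡ 3 mod 4` and `l k` is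
odd, that is, when `p ^ (l k) ≡ 3 mod 4`. Adding `4` to the numerator raises the exponent by one and
flips the sign. -/
theorem neg_one_pow_eq_of_prime_pow {p l k q : ℕ} (hq : q = p ^ l) (hp : Odd p) :
    ((-1) ^ (l * (2 * k) * (p - 1) / 4) : ℤ) = (if q ^ k % 4 = 3 then -1 else 1) ∧
    ((-1) ^ ((l * (2 * k) * (p - 1) + 4) / 4) : ℤ) = -(-1) ^ (l * (2 * k) * (p - 1) / 4) := by
  refine ⟨?_, by rw [Nat.add_div_right _ (by norm_num), pow_succ, mul_neg_one]⟩
  obtain ⟨h, rfl⟩ := hp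
  have e1 : l * (2 * k) * (2 * h + 1 - 1) / 4 = (l * k) * h := by
    rw [Nat.add_sub_cancel, show l * (2 * k) * (2 * h) = 4 * (l * k * h) by ring,
      Nat.mul_div_cancel_left _ (by norm_num)]
  rw [e1, hq, ← pow_mul, Nat.pow_mod]
  rcases Nat.even_or_odd h with hh | hh
  · have h1 : (2 * h + 1) % 4 = 1 := by
      obtain ⟨i, rfl⟩ := hh
      omega
    rw [h1, one_pow, (hh.mul_left _).neg_one_pow]
    norm_num
  · have h1 : (2 * h + 1) % 4 = 3 := by
      obtain ⟨i, rfl⟩ := hh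
      omega
    rw [h1]
    rcases Nat.even_or_odd (l * k) with hj | hj
    · rw [(hj.mul_right _).neg_one_pow]
      obtain ⟨i, hi⟩ := hj
      rw [hi, ← two_mul, pow_mul, Nat.pow_mod]
      norm_num
    · rw [(hj.mul hh).neg_one_pow]
      obtain ⟨i, hi⟩ := hj
      rw [hi, pow_succ, pow_mul, Nat.mul_mod, Nat.pow_mod]
      norm_num

end Parameters

theorem theorem6 {K L : Type*} [Field K] [Fintype K] [DecidableEq K] [Field L] [Fintype L]
    [Algebra K L] (p l m q : ℕ) (hp : p.Prime) (hq : q = p ^ l) (hK : Fintype.card K = q)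
    (hm : 2 ≤ m) (f g : L → K) (hf : ∀ x, f x = Algebra.trace K L x)
    (hg : ∀ y, g y = Algebra.trace K L (y ^ 2))
    (B : Module.Basis (Fin m) K L)
    {r : ℕ} (G : Matrix (Fin r) (Option (solutionSet f g)) L) (hG : rowCode G = codeFG f g)
    (C : Submodule K (solutionSet f g → K)) (hC : C = punctureFirst (subfieldCode B G)) :
    (q = 2 →
      IsOptimalCode C (2 ^ (2 * m - 1)) (2 * m) (2 ^ (2 * m - 2)) ∧
      MeetsGriesmerBound 2 (2 ^ (2 * m - 1)) (2 * m) (2 ^ (2 * m - 2)) ∧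
      weightEnumerator C =
        1 + (2 ^ (2 * m) - 2) * X ^ (2 ^ (2 * m - 2)) + X ^ (2 ^ (2 * m - 1)) ∧
      PermEquivalent C (reedMuller K 1 (2 * m - 1)) ∧
      IsOptimalCode (dualCode C) (2 ^ (2 * m - 1)) (2 ^ (2 * m - 1) - 2 * m) 4 ∧
      OptimalForSpherePacking 2 (2 ^ (2 * m - 1)) (2 ^ (2 * m - 1) - 2 * m) 4) ∧
    (p = 2 → 2 ≤ l →
      IsLinearCodeWithDist C (q ^ (2 * m - 1)) (2 * m + 1) ((q - 2) * q ^ (2 * m - 2)) ∧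
      IsWeightCode C 3 ∧
      HasWeightDistribution C
        [(0, 1),
         (((q : ℤ) - 2) * (q : ℤ) ^ (2 * m - 2), (q : ℚ) * ((q : ℚ) - 1) ^ 2 / 2),
         (((q : ℤ) - 1) * (q : ℤ) ^ (2 * m - 2),
            (q : ℚ) ^ (2 * m + 1) - (q : ℚ) ^ 3 + 2 * (q : ℚ) ^ 2 - 2 * (q : ℚ)),
         ((q : ℤ) ^ (2 * m - 1), ((q : ℚ) - 1) * ((q : ℚ) ^ 2 - (q : ℚ) + 2) / 2)] ∧
      IsLinearCodeWithDist (dualCode C) (q ^ (2 * m - 1)) (q ^ (2 * m - 1) - 2 * m - 1) 3) ∧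
    (Odd q → Odd m →
      IsLinearCodeWithDist C (q ^ (2 * m - 1)) (2 * m + 1)
        ((q - 1) * q ^ (2 * m - 2) - q ^ ((3 * m - 3) / 2)) ∧
      IsWeightCode C 4 ∧
      HasWeightDistribution C
        [(0, 1),
         (((q : ℤ) - 1) * (q : ℤ) ^ (2 * m - 2) - (q : ℤ) ^ ((3 * m - 3) / 2),
            (q : ℚ) ^ m * ((q : ℚ) - 1) ^ 2 / 2),
         (((q : ℤ) - 1) * (q : ℤ) ^ (2 * m - 2),
            (q : ℚ) ^ (2 * m + 1) - (q : ℚ) ^ (m + 2) + 2 * (q : ℚ) ^ (m + 1) - (q : ℚ) ^ m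
              - (q : ℚ)),
         (((q : ℤ) - 1) * (q : ℤ) ^ (2 * m - 2) + (q : ℤ) ^ ((3 * m - 3) / 2),
            (q : ℚ) ^ m * ((q : ℚ) - 1) ^ 2 / 2),
         ((q : ℤ) ^ (2 * m - 1), (q : ℚ) - 1)] ∧
      IsLinearCodeWithDist (dualCode C) (q ^ (2 * m - 1)) (q ^ (2 * m - 1) - 2 * m - 1) 3) ∧
    (Odd q → Even m →
      IsLinearCode C (q ^ (2 * m - 1)) (2 * m + 1) ∧
      IsWeightCode C 4 ∧
      HasWeightDistribution C
        [(0, 1),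
         (((q : ℤ) - 1) * (q : ℤ) ^ (2 * m - 2)
            + (q : ℤ) ^ ((3 * m - 4) / 2) * (-1) ^ ((l * m * (p - 1) + 4) / 4),
            (q : ℚ) ^ (m + 2) - 2 * (q : ℚ) ^ (m + 1) + (q : ℚ) ^ m),
         (((q : ℤ) - 1) * (q : ℤ) ^ (2 * m - 2)
            + ((q : ℤ) - 1) * (q : ℤ) ^ ((3 * m - 4) / 2) * (-1) ^ (l * m * (p - 1) / 4),
            (q : ℚ) ^ (m + 1) - (q : ℚ) ^ m),
         (((q : ℤ) - 1) * (q : ℤ) ^ (2 * m - 2),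
            (q : ℚ) ^ (2 * m + 1) - (q : ℚ) ^ (m + 2) + (q : ℚ) ^ (m + 1) - (q : ℚ)),
         ((q : ℤ) ^ (2 * m - 1), (q : ℚ) - 1)] ∧
      IsLinearCodeWithDist (dualCode C) (q ^ (2 * m - 1)) (q ^ (2 * m - 1) - 2 * m - 1) 3) := by
  have hg' : g = fun y => Algebra.trace K L (y ^ 2) := funext hg
  have hf' : f = fun x => Algebra.trace K L x := funext hf
  subst hf' hg'
  have hrank : Module.finrank K L = m := by
    rw [Module.finrank_eq_card_basis B, Fintype.card_fin]
  have hrange : C = LinearMap.range (traceEval K (traceSet K L)) := by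
    rw [hC]
    exact punctureFirst_subfieldCode_eq_range B _ _ G hG
  have hcard := hK
  have hchar : Odd q → ringChar K ≠ 2 := by
    intro hodd h2
    have := FiniteField.even_card_iff_char_two.1 h2
    rw [hcard] at this
    rw [Nat.odd_iff] at hodd
    omega
  have hq3 : Odd q → 3 ≤ q := by
    rintro ⟨j, hj⟩
    have : 1 < Fintype.card K := Fintype.one_lt_card
    omega
  refine ⟨fun h2 => ?_, fun h2 hl => ?_, fun hodd hmodd => ?_, fun hodd hmeven => ?_⟩
  · have hK2 : Fintype.card K = 2 := hK.trans h2
    rw [hrange]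
    refine ⟨isOptimalCode_of_card_eq_two hK2 hrank hm, ?_,
      weightEnumerator_of_card_eq_two hK2 hrank hm, permEquivalent_reedMuller hK2 hrank hm,
      isOptimalCode_dualCode_of_card_eq_two hK2 hrank hm, fun d hd => ?_⟩
    · have := meetsGriesmerBound_two (2 * m - 2)
      rwa [show 2 * m - 2 + 1 = 2 * m - 1 by omega, show 2 * m - 2 + 2 = 2 * m by omega] at this
    · have := not_satisfiesSpherePackingBound (a := 2 * m - 1) (by omega) hd
      rwa [show 2 * m - 1 + 1 = 2 * m by omega] at this
  · have : Fact p.Prime := ⟨hp⟩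
    have : CharP K p := charP_of_card_eq_prime_pow (hK.trans hq)
    subst h2
    refine parameters_of_charTwo hrank hm hK ?_ hrange
    rw [hq]
    exact Nat.pow_le_pow_right two_pos hl
  · obtain ⟨k, rfl⟩ := hmodd
    have := parameters_of_odd_of_odd (hchar hodd) hrank (by omega) hK (hq3 hodd) hrange
    rw [show 2 * (2 * k + 1) - 1 = 4 * k + 1 by omega, show 2 * (2 * k + 1) - 2 = 4 * k by omega,
      show (3 * (2 * k + 1) - 3) / 2 = 3 * k by omega]
    exact this
  · obtain ⟨k, rfl⟩ := hmeven.exists_two_nsmul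
    rw [smul_eq_mul] at *
    have hpodd : Odd p := by
      by_contra h
      rw [Nat.not_odd_iff_even, hp.even_iff] at h
      -- `l = 0` would give `q = 1`.
      have hl0 : l ≠ 0 := by
        rintro rfl
        have := hq3 hodd
        rw [pow_zero] at hq
        omega
      rw [hq, h, Nat.odd_pow_iff hl0] at hodd
      exact absurd hodd (by decide)
    obtain ⟨hs1, hs2⟩ := neg_one_pow_eq_of_prime_pow (k := k) hq hpodd
    have := parameters_of_odd_of_even (hchar hodd) hrank (by omega) hK (hq3 hodd) hs1 hrange
    rw [show 2 * (2 * k) - 1 = 4 * k - 1 by omega, show 2 * (2 * k) - 2 = 4 * k - 2 by omega,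
      show (3 * (2 * k) - 4) / 2 = 3 * k - 2 by omega, hs2, mul_neg, ← sub_eq_add_neg]
    exact this
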